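/- All quantum systems are finite dimensional. Let $\mathcal N^{A'\to B}$ be a quantum channel (CPTP map) with $A'\neq 0$, and let $U=U_{\mathcal N}^{A'\to BE}$ denote an isometric extension of it, i.e. an isometry with $\mathcal N(\rho)=\mathrm{Tr}_E\{U\rho U^\dagger\}$; the complementary channel is $\mathcal N^c(\rho)=\mathrm{Tr}_B\{U\rho U^\dagger\}$. Suppose that $\mathcal N$ is degradable, i.e. there is a channel $\mathcal D^{B\to E}$ with $\mathcal D(\mathcal N(\rho))=\mathcal N^c(\rho)$ for all states $\rho$. Let $H(S)_\rho=-\mathrm{Tr}\{\rho^S\log_2\rho^S\}$, $I(S;T)=H(S)+H(T)-H(ST)$, $I(S;T|C)=H(SC)+H(TC)-H(C)-H(STC)$ and $I(S\rangle T)=H(T)-H(ST)$. For $\lambda,\mu\ge 0$ let $$P_{\lambda,\mu}(\mathcal N)=\max_\sigma\; I(YX;B)_\sigma+\lambda\,[I(Y;B|X)_\sigma-I(Y;E|X)_\sigma]+\mu\,[I(YX;B)_\sigma-I(Y;E|X)_\sigma],$$ where the maximum is over all states $\sigma^{XYBE}=\sum_{x,y}p_{X,Y}(x,y)\,|x\rangle\langle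 x|^X\otimes|y\rangle\langle y|^Y\otimes U\rho_{x,y}^{A'}U^\dagger$ with $X$, $Y$ finite alphabets, $p_{X,Y}$ a probability distribution and $\rho_{x,y}$ arbitrary density operators (the private dynamic capacity formula), and let $$D_{\lambda,\mu}(\mathcal N)=\max_\sigma\; I(AX;B)_\sigma+\lambda\, I(A\rangle BX)_\sigma+\mu\,[I(X;B)_\sigma+I(A\rangle BX)_\sigma],$$ where the maximum is over all states $\sigma^{XABE}=\sum_x p_X(x)\,|x\rangle\langle x|^X\otimes (1_A\otimes U)\,\phi_x^{AA'}\,(1_A\otimes U)^\dagger$ with $X$ a finite alphabet, $p_X$ a probability distribution, $A$ a finite-dimensional system and $\phi_x^{AA'}$ pure states (the quantum dynamic capacity formula). Then both maxima exist, and $$P_{\lambda,\mu}(\mathcal N)\le D_{\lambda,\mu}(\mathcal N).$$ -/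

import Mathlib

open scoped Matrix Kronecker ComplexOrder

noncomputable section

namespace PrivateDynamic

/-! Quantum systems are finite dimensional: the system with orthonormal basis indexed by a finite
type `S` has operators `Matrix S S ℂ`; composite systems are indexed by products. -/

/-- Density operators. -/
def IsDensity {S : Type*} [Fintype S] (ρ : Matrix S S ℂ) : Prop :=
  ρ.PosSemidef ∧ ρ.trace = 1

/-- Partial trace over the second factor. -/
def traceRight {S T : Type*} [Fintype T] (ρ : Matrix (S × T) (S × T) ℂ) : Matrix S S ℂ :=
  Matrix.of fun i j => ∑ t, ρ (i, t) (j, t)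

/-- Partial trace over the first factor. -/
def traceLeft {S T : Type*} [Fintype S] (ρ : Matrix (S × T) (S × T) ℂ) : Matrix T T ℂ :=
  Matrix.of fun i j => ∑ s, ρ (s, i) (s, j)

/-- Partial trace over the middle factor of a tripartite system. -/
def traceMid {S T C : Type*} [Fintype T] (ρ : Matrix (S × T × C) (S × T × C) ℂ) :
    Matrix (S × C) (S × C) ℂ :=
  Matrix.of fun i j => ∑ t, ρ (i.1, t, i.2) (j.1, t, j.2)

/-- The von Neumann entropy `H(ρ) = -Tr (ρ log₂ ρ)`; as `Real.logb 2 0 = 0`, the convention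
`0 log 0 = 0` holds. -/
def entropy {S : Type*} [Fintype S] [DecidableEq S] (ρ : Matrix S S ℂ) : ℝ :=
  -(ρ * cfc (Real.logb 2) ρ).trace.re

/-- `I(S;T) = H(S) + H(T) - H(ST)`. -/
def mutualInfo {S T : Type*} [Fintype S] [DecidableEq S] [Fintype T] [DecidableEq T]
    (ρ : Matrix (S × T) (S × T) ℂ) : ℝ :=
  entropy (traceRight ρ) + entropy (traceLeft ρ) - entropy ρ

/-- `I(S;T|C) = H(SC) + H(TC) - H(C) - H(STC)`. -/
def condMutualInfo {S T C : Type*} [Fintype S] [DecidableEq S] [Fintype T] [DecidableEq T]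
    [Fintype C] [DecidableEq C] (ρ : Matrix (S × T × C) (S × T × C) ℂ) : ℝ :=
  entropy (traceMid ρ) + entropy (traceLeft ρ) - entropy (traceLeft (traceLeft ρ)) - entropy ρ

/-- The coherent information `I(S⟩T) = H(T) - H(ST)`. -/
def coherentInfo {S T : Type*} [Fintype S] [DecidableEq S] [Fintype T] [DecidableEq T]
    (ρ : Matrix (S × T) (S × T) ℂ) : ℝ :=
  entropy (traceLeft ρ) - entropy ρ

/-- Quantum channels (CPTP maps), in Kraus form. -/
def IsChannel {A B : Type*} [Fintype A] [DecidableEq A] [Fintype B]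
    (N : Matrix A A ℂ →ₗ[ℂ] Matrix B B ℂ) : Prop :=
  ∃ (k : ℕ) (K : Fin k → Matrix B A ℂ),
    (∀ ρ, N ρ = ∑ i, K i * ρ * (K i)ᴴ) ∧ ∑ i, (K i)ᴴ * K i = 1

/-- `V : A → B ⊗ E` is an isometric extension of `N`. -/
def IsIsometricExtension {A B E : Type*} [Fintype A] [DecidableEq A] [Fintype B] [Fintype E]
    (N : Matrix A A ℂ →ₗ[ℂ] Matrix B B ℂ) (V : Matrix (B × E) A ℂ) : Prop :=
  Vᴴ * V = 1 ∧ ∀ ρ, N ρ = traceRight (V * ρ * Vᴴ)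

/-- `N` is degradable: for the complementary channel `ρ ↦ Tr_B (V ρ V†)` of an isometric
extension `V` of `N` there is a degrading channel from `B` to `E`. (The complementary channel is
unique up to an isometry of the environment, so it does not matter which extension is used.) -/
def IsDegradable {A B : Type*} [Fintype A] [DecidableEq A] [Fintype B] [DecidableEq B]
    (N : Matrix A A ℂ →ₗ[ℂ] Matrix B B ℂ) : Prop :=
  ∃ (E : Type) (_ : Fintype E) (V : Matrix (B × E) A ℂ) (D : Matrix B B ℂ →ₗ[ℂ] Matrix E E ℂ),
    IsIsometricExtension N V ∧ IsChannel D ∧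
      ∀ ρ, IsDensity ρ → D (N ρ) = traceLeft (V * ρ * Vᴴ)

/-- `σ^{XYBE} = ∑_{x,y} p(x,y) |x⟩⟨x| ⊗ |y⟩⟨y| ⊗ V ρ_{x,y} V†`. -/
def privateState {A B E X Y : Type*} [Fintype A] [Fintype X] [DecidableEq X] [Fintype Y]
    [DecidableEq Y] (V : Matrix (B × E) A ℂ) (p : X → Y → ℝ) (ρ : X → Y → Matrix A A ℂ) :
    Matrix (X × Y × B × E) (X × Y × B × E) ℂ :=
  ∑ x, ∑ y, (p x y : ℂ) •
    (Matrix.single x x (1 : ℂ) ⊗ₖ (Matrix.single y y (1 : ℂ) ⊗ₖ (V * ρ x y * Vᴴ)))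

/-- `I(YX;B) + lam [I(Y;B|X) - I(Y;E|X)] + mu [I(YX;B) - I(Y;E|X)]` for a state of `XYBE`. -/
def privateObjective {B E X Y : Type*} [Fintype B] [DecidableEq B] [Fintype E] [DecidableEq E]
    [Fintype X] [DecidableEq X] [Fintype Y] [DecidableEq Y] (lam mu : ℝ)
    (σ : Matrix (X × Y × B × E) (X × Y × B × E) ℂ) : ℝ :=
  -- the marginals on `(YX)B`, `YBX` and `YEX`
  let σYX_B : Matrix ((Y × X) × B) ((Y × X) × B) ℂ :=
    Matrix.of fun i j => ∑ e, σ (i.1.2, i.1.1, i.2, e) (j.1.2, j.1.1, j.2, e)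
  let σYBX : Matrix (Y × B × X) (Y × B × X) ℂ :=
    Matrix.of fun i j => ∑ e, σ (i.2.2, i.1, i.2.1, e) (j.2.2, j.1, j.2.1, e)
  let σYEX : Matrix (Y × E × X) (Y × E × X) ℂ :=
    Matrix.of fun i j => ∑ b, σ (i.2.2, i.1, b, i.2.1) (j.2.2, j.1, b, j.2.1)
  mutualInfo σYX_B + lam * (condMutualInfo σYBX - condMutualInfo σYEX) +
    mu * (mutualInfo σYX_B - condMutualInfo σYEX)

/-- The values of the private dynamic objective on all states `σ^{XYBE}` that arise from finite
alphabets `X`, `Y`, a joint distribution `p`, (mixed) input states `ρ_{x,y}` and an isometric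
extension of `N`. -/
def privateValues {A B : Type*} [Fintype A] [DecidableEq A] [Fintype B] [DecidableEq B]
    (lam mu : ℝ) (N : Matrix A A ℂ →ₗ[ℂ] Matrix B B ℂ) : Set ℝ :=
  {v | ∃ (X Y E : Type) (_ : Fintype X) (_ : DecidableEq X) (_ : Fintype Y) (_ : DecidableEq Y)
      (_ : Fintype E) (_ : DecidableEq E) (V : Matrix (B × E) A ℂ) (p : X → Y → ℝ)
      (ρ : X → Y → Matrix A A ℂ),
    IsIsometricExtension N V ∧ (∀ x y, 0 ≤ p x y) ∧ ∑ x, ∑ y, p x y = 1 ∧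
      (∀ x y, IsDensity (ρ x y)) ∧ v = privateObjective lam mu (privateState V p ρ)}

/-- The private dynamic capacity formula `P_{lam,mu}(N)`. -/
def privateFormula {A B : Type*} [Fintype A] [DecidableEq A] [Fintype B] [DecidableEq B]
    (lam mu : ℝ) (N : Matrix A A ℂ →ₗ[ℂ] Matrix B B ℂ) : ℝ :=
  sSup (privateValues lam mu N)

/-- `σ^{XRBE} = ∑_x p(x) |x⟩⟨x| ⊗ (1_R ⊗ V) |φ_x⟩⟨φ_x| (1_R ⊗ V)†`, where `φ_x` is a vector of
`R ⊗ A`, the reference system `R` being kept by the sender and `A` being the channel input. -/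
def quantumState {A B E X R : Type*} [Fintype A] [Fintype X] [DecidableEq X] [Fintype R]
    [DecidableEq R] (V : Matrix (B × E) A ℂ) (p : X → ℝ) (φ : X → R × A → ℂ) :
    Matrix (X × R × B × E) (X × R × B × E) ℂ :=
  ∑ x, (p x : ℂ) • (Matrix.single x x (1 : ℂ) ⊗ₖ
    (((1 : Matrix R R ℂ) ⊗ₖ V) * Matrix.vecMulVec (φ x) (star (φ x)) *
      ((1 : Matrix R R ℂ) ⊗ₖ V)ᴴ))

/-- `I(RX;B) + lam I(R⟩BX) + mu [I(X;B) + I(R⟩BX)]` for a state of `XRBE`. -/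
def quantumObjective {B E X R : Type*} [Fintype B] [DecidableEq B] [Fintype E]
    [Fintype X] [DecidableEq X] [Fintype R] [DecidableEq R] (lam mu : ℝ)
    (σ : Matrix (X × R × B × E) (X × R × B × E) ℂ) : ℝ :=
  -- the marginals on `(RX)B`, `R(BX)` and `XB`
  let σRX_B : Matrix ((R × X) × B) ((R × X) × B) ℂ :=
    Matrix.of fun i j => ∑ e, σ (i.1.2, i.1.1, i.2, e) (j.1.2, j.1.1, j.2, e)
  let σR_BX : Matrix (R × B × X) (R × B × X) ℂ :=
    Matrix.of fun i j => ∑ e, σ (i.2.2, i.1, i.2.1, e) (j.2.2, j.1, j.2.1, e)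
  let σXB : Matrix (X × B) (X × B) ℂ :=
    Matrix.of fun i j => ∑ r, ∑ e, σ (i.1, r, i.2, e) (j.1, r, j.2, e)
  mutualInfo σRX_B + lam * coherentInfo σR_BX + mu * (mutualInfo σXB + coherentInfo σR_BX)

/-- The values of the quantum dynamic objective on all states `σ^{XRBE}` that arise from a finite
alphabet `X`, a distribution `p`, a finite-dimensional reference system `R`, unit vectors `φ_x` of
`R ⊗ A` and an isometric extension of `N`. -/
def quantumValues {A B : Type*} [Fintype A] [DecidableEq A] [Fintype B] [DecidableEq B]
    (lam mu : ℝ) (N : Matrix A A ℂ →ₗ[ℂ] Matrix B B ℂ) : Set ℝ :=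
  {v | ∃ (X R E : Type) (_ : Fintype X) (_ : DecidableEq X) (_ : Fintype R) (_ : DecidableEq R)
      (_ : Fintype E) (V : Matrix (B × E) A ℂ) (p : X → ℝ) (φ : X → R × A → ℂ),
    IsIsometricExtension N V ∧ (∀ x, 0 ≤ p x) ∧ ∑ x, p x = 1 ∧
      (∀ x, ∑ i, ‖φ x i‖ ^ 2 = 1) ∧ v = quantumObjective lam mu (quantumState V p φ)}

/-- The quantum dynamic capacity formula `D_{lam,mu}(N)`. -/
def quantumFormula {A B : Type*} [Fintype A] [DecidableEq A] [Fintype B] [DecidableEq B]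
    (lam mu : ℝ) (N : Matrix A A ℂ →ₗ[ℂ] Matrix B B ℂ) : ℝ :=
  sSup (quantumValues lam mu N)

end PrivateDynamic

end

set_option linter.unusedSectionVars false

open scoped Matrix Kronecker ComplexOrder

namespace PrivateDynamic

/-! Replace an ensemble by its unnormalized inputs `τ x y` = p(x,y) ρ_{x,y}, and entropy by its
degree-one homogeneous version `nent`. Write τ_x = ∑_y `τ x y`, τ = ∑_x τ_x, M for the complementary
channel, n for `nent`. The private objective becomes (1+μ)H(Nτ) + ∑_x [λ n(Nτ_x) - (λ+μ) n(Mτ_x)] +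
∑_{x,y} [(λ+μ) n(Mτ_{xy}) - (1+λ+μ) n(Nτ_{xy})] (`privateObjective_eq`). Purity of the state on RBE
turns the quantum objective into (1+μ)H(Nτ) + ∑_x [n(τ_x) + λ n(Nτ_x) - (1+λ+μ) n(Mτ_x)]
(`quantumObjective_eq`).

The two are compared for each x, on the same τ_x (`privateForm_le_quantumForm`). Degradability gives
n(Mτ_{xy}) ≤ n(Nτ_{xy}), so the inner sum is at most -∑_y n(Mτ_{xy}). The Holevo quantity does not
grow under M, so n(Mτ_x) - ∑_y n(Mτ_{xy}) ≤ n(τ_x) - ∑_y n(τ_{xy}) ≤ n(τ_x). Purifying each τ_x then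
gives an admissible quantum state.

The inequality n(M·) ≤ n(N·) (`entropy_complement_le`) is again Holevo monotonicity, for the
degrading channel and a decomposition of the input into pure states, on which both outputs have the
same entropy. Holevo monotonicity follows from that of relative entropy under partial trace
(`relEntropy_traceRight_le`). Relative entropy is a regularized integral over t of maxima of the
quadratic functionals `resolventForm`; passing to a marginal restricts the maximization to operators
Y ⊗ 1.

For the maxima, the pairs (barycenter, value) of all two-level ensembles form a convex hull of a
continuous image of a convex hull, starting from the compact set of density operators. It is compact
by Carathéodory, so no prior bound on the alphabets is needed (`exists_isMax_ensemble`). The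
environment can be fixed, since output entropies of the complementary channel do not depend on the
extension (`entropy_complement_eq`). -/

/-- The function `x ↦ -x log₂ x`. -/
noncomputable def eta (x : ℝ) : ℝ := Real.negMulLog x / Real.log 2

@[simp] lemma eta_zero : eta 0 = 0 := by simp [eta]

lemma eta_mul (x y : ℝ) : eta (x * y) = y * eta x + x * eta y := by
  simp only [eta, Real.negMulLog_mul]; ring

lemma continuous_eta : Continuous eta := Real.continuous_negMulLog.div_const _

/-! ### Entropy as a function of the spectrum -/

section Spectral

variable {S : Type*} [Fintype S] [DecidableEq S]

lemma entropy_eq_cfc {ρ : Matrix S S ℂ} (hρ : ρ.IsHermitian) :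
    entropy ρ = (cfc eta ρ).trace.re := by
  -- The spectrum is finite, hence discrete, so even the logarithm at 0 is continuous on it.
  have hf : ∀ f : ℝ → ℝ, ContinuousOn f (spectrum ℝ ρ) := fun f => by
    rw [continuousOn_iff_continuous_domRestrict]; fun_prop
  have hρ' : IsSelfAdjoint ρ := hρ
  have h1 : ρ * cfc (Real.logb 2) ρ = cfc (fun x => x * Real.logb 2 x) ρ := by
    conv_lhs => enter [1]; rw [← cfc_id ℝ ρ]
    rw [← cfc_mul _ _ _ (hf _) (hf _)]; rfl
  have h2 : cfc eta ρ = - cfc (fun x => x * Real.logb 2 x) ρ := by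
    rw [← cfc_neg]
    congr 1
    funext x
    simp only [eta, Real.negMulLog, Real.logb]
    ring
  rw [entropy, h1, h2]
  simp

lemma trace_cfc {ρ : Matrix S S ℂ} (hρ : ρ.IsHermitian) (f : ℝ → ℝ) :
    (cfc f ρ).trace = ∑ i, (f (hρ.eigenvalues i) : ℂ) := by
  rw [hρ.cfc_eq, Matrix.IsHermitian.cfc, Unitary.conjStarAlgAut_apply, Matrix.trace_mul_cycle]
  simp [Matrix.trace]

lemma entropy_eq_sum {ρ : Matrix S S ℂ} (hρ : ρ.IsHermitian) :
    entropy ρ = ∑ i, eta (hρ.eigenvalues i) := by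
  simp [entropy_eq_cfc hρ, trace_cfc hρ]

/-- Entropy depends only on the characteristic polynomial; transposes, reindexings, block sums and
`M * Mᴴ` versus `Mᴴ * M` then reduce to polynomial identities. -/
lemma entropy_eq_roots {ρ : Matrix S S ℂ} (hρ : ρ.IsHermitian) :
    entropy ρ = (ρ.charpoly.roots.map fun z => eta z.re).sum := by
  rw [entropy_eq_sum hρ, hρ.roots_charpoly_eq_eigenvalues]
  simp [Multiset.map_map]

lemma entropy_smul {ρ : Matrix S S ℂ} (hρ : ρ.IsHermitian) (c : ℝ) :
    entropy ((c : ℂ) • ρ) = c * entropy ρ + ρ.trace.re * eta c := by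
  have hf : ∀ f : ℝ → ℝ, ContinuousOn f (spectrum ℝ ρ) := fun f => by
    rw [continuousOn_iff_continuous_domRestrict]; fun_prop
  have hρ' : IsSelfAdjoint ρ := hρ
  have hc : ((c : ℂ) • ρ).IsHermitian := by
    rw [Matrix.IsHermitian, Matrix.conjTranspose_smul, hρ.eq]; simp
  have h1 : cfc eta ((c : ℂ) • ρ) = cfc (fun x => eta (c * x)) ρ := by
    have h := cfc_comp_smul c eta ρ continuous_eta.continuousOn
    rw [Complex.coe_smul]
    exact h.symm
  rw [entropy_eq_cfc hc, h1, trace_cfc hρ, entropy_eq_sum hρ, hρ.trace_eq_sum_eigenvalues]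
  simp only [eta_mul, Complex.re_sum, Complex.ofReal_re, Finset.mul_sum, Finset.sum_mul,
    ← Finset.sum_add_distrib, Complex.coe_algebraMap]
  exact Finset.sum_congr rfl fun i _ => by ring

/-- Each eigenvalue is at most the trace, and the logarithm is increasing. This is nonnegativity of
entropy without normalization. -/
lemma eta_trace_le_entropy {ρ : Matrix S S ℂ} (hρ : ρ.PosSemidef) :
    eta ρ.trace.re ≤ entropy ρ := by
  have h2 : 0 < Real.log 2 := Real.log_pos one_lt_two
  rw [entropy_eq_sum hρ.1, hρ.1.trace_eq_sum_eigenvalues]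
  simp only [Complex.re_sum, eta, ← Finset.sum_div, Real.negMulLog]
  gcongr
  set l := hρ.1.eigenvalues
  have hl : ∀ i, 0 ≤ l i := hρ.eigenvalues_nonneg
  simp only [Complex.coe_algebraMap, Complex.ofReal_re, neg_mul, Finset.sum_neg_distrib,
    neg_le_neg_iff, Finset.sum_mul]
  refine Finset.sum_le_sum fun i _ => ?_
  rcases (hl i).eq_or_lt with h | h
  · simp [← h]
  · gcongr
    exact Finset.single_le_sum (fun j _ => hl j) (Finset.mem_univ i)

lemma continuousOn_entropy :
    ContinuousOn (entropy : Matrix S S ℂ → ℝ) {ρ | ρ.IsHermitian} := by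
  have h : ContinuousOn (fun ρ : Matrix S S ℂ => (cfc eta ρ).trace.re) {ρ | ρ.IsHermitian} := by
    have h1 : ContinuousOn (cfc eta : Matrix S S ℂ → Matrix S S ℂ) {ρ | ρ.IsHermitian} := by
      open scoped Matrix.Norms.L2Operator in
      exact ContinuousOn.cfc_of_mem_nhdsSet (s := Set.univ) eta Filter.univ_mem continuousOn_id
        (fun ρ hρ => hρ) continuous_eta.continuousOn
    exact Complex.continuous_re.comp_continuousOn
      ((Continuous.matrix_trace continuous_id).comp_continuousOn h1)
  exact h.congr fun ρ hρ => entropy_eq_cfc hρ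

lemma entropy_transpose {ρ : Matrix S S ℂ} (hρ : ρ.IsHermitian) : entropy ρᵀ = entropy ρ := by
  rw [entropy_eq_roots hρ, entropy_eq_roots hρ.transpose, Matrix.charpoly_transpose]

lemma entropy_diagonal (d : S → ℝ) :
    entropy (Matrix.diagonal fun i => (d i : ℂ)) = ∑ i, eta (d i) := by
  rw [entropy_eq_roots (Matrix.isHermitian_diagonal_of_self_adjoint _ (by
    ext i; simp)), Matrix.charpoly_diagonal, Polynomial.roots_prod _ _
    (Finset.prod_ne_zero_iff.2 fun k _ => Polynomial.X_sub_C_ne_zero _)]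
  simp only [Polynomial.roots_X_sub_C, Multiset.map_bind, Multiset.sum_bind]
  simp

end Spectral

/-! ### Entropy and characteristic polynomials -/

/-- The extra roots are 0 and `eta 0 = 0`. The characteristic polynomials of `M * Mᴴ` and `Mᴴ * M`
agree up to such powers of X. -/
lemma sum_roots_X_pow_mul {p : Polynomial ℂ} (hp : p ≠ 0) (n : ℕ) :
    ((Polynomial.X ^ n * p).roots.map fun z : ℂ => eta z.re).sum
      = (p.roots.map fun z : ℂ => eta z.re).sum := by
  rw [Polynomial.roots_mul (mul_ne_zero (pow_ne_zero _ Polynomial.X_ne_zero) hp)]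
  simp [Multiset.nsmul_singleton]

/-- `M M†` and `M† M` have the same entropy. -/
lemma entropy_mul_conjTranspose {S T : Type*} [Fintype S] [DecidableEq S] [Fintype T]
    [DecidableEq T] (M : Matrix S T ℂ) : entropy (M * Mᴴ) = entropy (Mᴴ * M) := by
  rw [entropy_eq_roots (Matrix.isHermitian_mul_conjTranspose_self M),
    entropy_eq_roots (Matrix.isHermitian_conjTranspose_mul_self M),
    ← sum_roots_X_pow_mul (Matrix.charpoly_monic _).ne_zero (Fintype.card T),
    Matrix.charpoly_mul_comm', sum_roots_X_pow_mul (Matrix.charpoly_monic _).ne_zero]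

lemma charpoly_blockDiagonal {S o : Type*} [Fintype S] [DecidableEq S] [Fintype o]
    [DecidableEq o] (B : o → Matrix S S ℂ) :
    (Matrix.blockDiagonal B).charpoly = ∏ k, (B k).charpoly := by
  rw [Matrix.charpoly]
  have : (Matrix.blockDiagonal B).charmatrix = Matrix.blockDiagonal fun k => (B k).charmatrix := by
    ext ⟨i, k⟩ ⟨j, l⟩
    simp only [Matrix.charmatrix_apply, Matrix.blockDiagonal_apply, Matrix.diagonal_apply,
      Prod.mk.injEq]
    by_cases h : k = l <;> simp [h]
  rw [this, Matrix.det_blockDiagonal]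
  rfl

/-- The entropy of a block diagonal operator is the sum of the entropies of the blocks. -/
lemma entropy_of_blocks {n S o : Type*} [Fintype n] [DecidableEq n] [Fintype S] [DecidableEq S]
    [Fintype o] [DecidableEq o] (e : n ≃ S × o) (B : o → Matrix S S ℂ)
    (hB : ∀ k, (B k).IsHermitian) (M : Matrix n n ℂ)
    (hM : ∀ i j, M i j = if (e i).2 = (e j).2 then B (e i).2 (e i).1 (e j).1 else 0) :
    entropy M = ∑ k, entropy (B k) := by
  have h1 : M = (Matrix.blockDiagonal B).submatrix e e := by
    ext i j
    rw [hM, Matrix.submatrix_apply, Matrix.blockDiagonal_apply]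
  have h2 : (Matrix.blockDiagonal B).IsHermitian := by
    rw [Matrix.IsHermitian, Matrix.blockDiagonal_conjTranspose]
    congr 1
    funext k
    exact hB k
  have h3 : M.charpoly = ∏ k, (B k).charpoly := by
    rw [← charpoly_blockDiagonal, h1]
    have h := Matrix.charpoly_reindex e.symm (Matrix.blockDiagonal B)
    rw [Matrix.reindex_apply, Equiv.symm_symm] at h
    exact h
  have h4 : M.IsHermitian := by rw [h1]; exact h2.submatrix e
  have h5 : (∏ k, (B k).charpoly) ≠ 0 :=
    Finset.prod_ne_zero_iff.2 fun k _ => (Matrix.charpoly_monic _).ne_zero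
  rw [entropy_eq_roots h4, h3, Polynomial.roots_prod _ _ h5, Multiset.map_bind,
    Multiset.sum_bind]
  exact congrArg Multiset.sum (Multiset.map_congr rfl fun k _ => (entropy_eq_roots (hB k)).symm)

end PrivateDynamic

namespace PrivateDynamic

/-! ### Monotonicity of the relative entropy under partial traces -/

section RelativeEntropy

variable {S : Type*} [Fintype S] [DecidableEq S]

/-- The overlaps of the eigenvectors of two Hermitian matrices. -/
noncomputable def overlap {ρ σ : Matrix S S ℂ} (hρ : ρ.IsHermitian) (hσ : σ.IsHermitian) :
    Matrix S S ℂ :=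
  (hσ.eigenvectorUnitary : Matrix S S ℂ)ᴴ * (hρ.eigenvectorUnitary : Matrix S S ℂ)

lemma eigenvectorUnitary_conjTranspose_mul {ρ : Matrix S S ℂ} (hρ : ρ.IsHermitian) :
    (hρ.eigenvectorUnitary : Matrix S S ℂ)ᴴ * (hρ.eigenvectorUnitary : Matrix S S ℂ) = 1 :=
  Unitary.coe_star_mul_self hρ.eigenvectorUnitary

lemma eigenvectorUnitary_mul_conjTranspose {ρ : Matrix S S ℂ} (hρ : ρ.IsHermitian) :
    (hρ.eigenvectorUnitary : Matrix S S ℂ) * (hρ.eigenvectorUnitary : Matrix S S ℂ)ᴴ = 1 :=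
  Unitary.coe_mul_star_self hρ.eigenvectorUnitary

lemma spectral_mul {ρ : Matrix S S ℂ} (hρ : ρ.IsHermitian) :
    ρ = (hρ.eigenvectorUnitary : Matrix S S ℂ) *
      Matrix.diagonal (fun i => (hρ.eigenvalues i : ℂ)) *
        (hρ.eigenvectorUnitary : Matrix S S ℂ)ᴴ := by
  conv_lhs => rw [hρ.spectral_theorem, Unitary.conjStarAlgAut_apply]
  rfl

lemma cfc_spectral {ρ : Matrix S S ℂ} (hρ : ρ.IsHermitian) (f : ℝ → ℝ) :
    cfc f ρ = (hρ.eigenvectorUnitary : Matrix S S ℂ) *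
      Matrix.diagonal (fun i => (f (hρ.eigenvalues i) : ℂ)) *
        (hρ.eigenvectorUnitary : Matrix S S ℂ)ᴴ := by
  rw [hρ.cfc_eq, Matrix.IsHermitian.cfc, Unitary.conjStarAlgAut_apply]
  rfl

lemma trace_diagonal_mul_mul_conjTranspose (d e : S → ℂ) (x : Matrix S S ℂ) :
    (Matrix.diagonal d * (x * (Matrix.diagonal e * xᴴ))).trace =
      ∑ i, ∑ j, d i * e j * ((‖x i j‖ ^ 2 : ℝ) : ℂ) := by
  simp only [Matrix.trace, Matrix.diag, Matrix.diagonal_mul]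
  simp only [Matrix.mul_apply (M := x), Matrix.diagonal_mul, Matrix.conjTranspose_apply,
    Finset.mul_sum]
  refine Finset.sum_congr rfl fun i _ => Finset.sum_congr rfl fun j _ => ?_
  rw [RCLike.star_def, Complex.ofReal_pow, ← Complex.mul_conj']
  ring

lemma trace_cfc_mul_cfc {ρ σ : Matrix S S ℂ} (hρ : ρ.IsHermitian) (hσ : σ.IsHermitian)
    (f g : ℝ → ℝ) : (cfc f ρ * cfc g σ).trace.re =
      ∑ i, ∑ j, f (hρ.eigenvalues j) * g (hσ.eigenvalues i) * ‖overlap hρ hσ i j‖ ^ 2 := by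
  have h := trace_diagonal_mul_mul_conjTranspose (fun i => (g (hσ.eigenvalues i) : ℂ))
    (fun j => (f (hρ.eigenvalues j) : ℂ)) (overlap hρ hσ)
  have h2 : (cfc f ρ * cfc g σ).trace = (Matrix.diagonal (fun i => (g (hσ.eigenvalues i) : ℂ)) *
      (overlap hρ hσ * (Matrix.diagonal (fun j => (f (hρ.eigenvalues j) : ℂ)) *
        (overlap hρ hσ)ᴴ))).trace := by
    rw [cfc_spectral hρ, cfc_spectral hσ, overlap, Matrix.conjTranspose_mul,
      Matrix.conjTranspose_conjTranspose, Matrix.trace_mul_comm, Matrix.mul_assoc,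
      Matrix.mul_assoc, Matrix.trace_mul_comm]
    simp only [Matrix.mul_assoc]
  rw [h2, h]
  simp only [Complex.re_sum, ← Complex.ofReal_mul, Complex.ofReal_re]
  exact Finset.sum_congr rfl fun i _ => Finset.sum_congr rfl fun j _ => by ring

/-- The concave quadratic functional whose supremum over `X` is the quadratic form of the
resolvent of the relative modular operator. -/
noncomputable def resolventForm (t : ℝ) (ρ σ X : Matrix S S ℂ) : ℝ :=
  2 * (ρ * X).trace.re - (σ * (X * Xᴴ)).trace.re - t * (ρ * (Xᴴ * X)).trace.re

/-- In eigenbases of σ on the left and ρ on the right the functional decouples into one scalar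
quadratic per matrix entry, so it can be maximized entrywise. -/
lemma resolventForm_spectral {ρ σ : Matrix S S ℂ} (hρ : ρ.IsHermitian) (hσ : σ.IsHermitian)
    (t : ℝ) (x : Matrix S S ℂ) :
    resolventForm t ρ σ ((hσ.eigenvectorUnitary : Matrix S S ℂ) * x *
      (hρ.eigenvectorUnitary : Matrix S S ℂ)ᴴ) =
    ∑ i, ∑ j, (2 * (hρ.eigenvalues j * (star (overlap hρ hσ i j) * x i j).re) -
      (hσ.eigenvalues i + t * hρ.eigenvalues j) * ‖x i j‖ ^ 2) := by
  set U := (hρ.eigenvectorUnitary : Matrix S S ℂ) with hU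
  set W := (hσ.eigenvectorUnitary : Matrix S S ℂ) with hW
  have hUU : Uᴴ * U = 1 := eigenvectorUnitary_conjTranspose_mul hρ
  have hWW : Wᴴ * W = 1 := eigenvectorUnitary_conjTranspose_mul hσ
  set dr := Matrix.diagonal (fun i => (hρ.eigenvalues i : ℂ)) with hdr
  set ds := Matrix.diagonal (fun i => (hσ.eigenvalues i : ℂ)) with hds
  have h1 : (ρ * (W * x * Uᴴ)).trace = (dr * ((overlap hρ hσ)ᴴ * x)).trace := by
    conv_lhs => rw [spectral_mul hρ]
    rw [overlap, ← hU, ← hW, ← hdr, Matrix.conjTranspose_mul, Matrix.conjTranspose_conjTranspose]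
    calc (U * dr * Uᴴ * (W * x * Uᴴ)).trace = (U * (dr * Uᴴ * (W * x * Uᴴ))).trace := by
          simp only [Matrix.mul_assoc]
      _ = (dr * Uᴴ * W * x * (Uᴴ * U)).trace := by
          rw [Matrix.trace_mul_comm]; simp only [Matrix.mul_assoc]
      _ = _ := by rw [hUU]; simp only [Matrix.mul_assoc, Matrix.mul_one]
  have h2 : (σ * ((W * x * Uᴴ) * (W * x * Uᴴ)ᴴ)).trace =
      (ds * (x * (Matrix.diagonal (fun _ => (1 : ℂ)) * xᴴ))).trace := by
    conv_lhs => enter [1, 1]; rw [spectral_mul hσ]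
    rw [← hW, ← hds, Matrix.conjTranspose_mul, Matrix.conjTranspose_mul,
      Matrix.conjTranspose_conjTranspose, Matrix.diagonal_one, Matrix.one_mul]
    calc (W * ds * Wᴴ * (W * x * Uᴴ * (U * (xᴴ * Wᴴ)))).trace
        = (W * ((ds * (Wᴴ * W)) * x * (Uᴴ * U) * xᴴ * Wᴴ)).trace := by
          simp only [Matrix.mul_assoc]
      _ = _ := by
          rw [hUU, hWW, Matrix.trace_mul_comm]
          simp only [Matrix.mul_assoc, hWW, Matrix.mul_one]
  have h3 : (ρ * ((W * x * Uᴴ)ᴴ * (W * x * Uᴴ))).trace =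
      (Matrix.diagonal (fun _ => (1 : ℂ)) * (x * (dr * xᴴ))).trace := by
    conv_lhs => enter [1, 1]; rw [spectral_mul hρ]
    rw [← hU, ← hdr, Matrix.conjTranspose_mul, Matrix.conjTranspose_mul,
      Matrix.conjTranspose_conjTranspose, Matrix.diagonal_one, Matrix.one_mul]
    calc (U * dr * Uᴴ * (U * (xᴴ * Wᴴ) * (W * x * Uᴴ))).trace
        = (U * ((dr * (Uᴴ * U)) * xᴴ * (Wᴴ * W) * x * Uᴴ)).trace := by
          simp only [Matrix.mul_assoc]
      _ = (dr * xᴴ * x).trace := by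
          rw [hUU, hWW, Matrix.trace_mul_comm]
          simp only [Matrix.mul_assoc, hUU, Matrix.mul_one]
      _ = _ := by rw [Matrix.trace_mul_comm]
  have h4 : (dr * ((overlap hρ hσ)ᴴ * x)).trace =
      ∑ i, ∑ j, (hρ.eigenvalues j : ℂ) * (star (overlap hρ hσ i j) * x i j) := by
    rw [Finset.sum_comm]
    simp only [hdr, Matrix.trace, Matrix.diag, Matrix.diagonal_mul]
    simp only [Matrix.mul_apply, Matrix.conjTranspose_apply, Finset.mul_sum]
  rw [resolventForm, h1, h2, h3, h4, hds, hdr, trace_diagonal_mul_mul_conjTranspose,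
    trace_diagonal_mul_mul_conjTranspose]
  simp only [Complex.re_sum, Complex.re_ofReal_mul, mul_one, one_mul, Complex.ofReal_re,
    Finset.mul_sum, ← Finset.sum_sub_distrib]
  exact Finset.sum_congr rfl fun i _ => Finset.sum_congr rfl fun j _ => by ring

/-- The maximum of `resolventForm`. -/
noncomputable def resolventMax {ρ σ : Matrix S S ℂ} (hρ : ρ.IsHermitian) (hσ : σ.IsHermitian)
    (t : ℝ) : ℝ :=
  ∑ i, ∑ j, hρ.eigenvalues j ^ 2 * ‖overlap hρ hσ i j‖ ^ 2 /
    (hσ.eigenvalues i + t * hρ.eigenvalues j)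

/-- Completing the square; equality holds at x = (r/d) m. -/
lemma two_mul_re_star_mul_sub_le {m x : ℂ} {r d : ℝ} (hd : 0 < d) :
    2 * (r * (star m * x).re) - d * ‖x‖ ^ 2 ≤ r ^ 2 * ‖m‖ ^ 2 / d := by
  rw [le_div_iff₀ hd, Complex.sq_norm, Complex.sq_norm, Complex.normSq_apply,
    Complex.normSq_apply]
  simp only [RCLike.star_def, Complex.mul_re, Complex.conj_re, Complex.conj_im]
  nlinarith [sq_nonneg (r * m.re - d * x.re), sq_nonneg (r * m.im - d * x.im)]

lemma two_mul_re_star_mul_sub_eq {m : ℂ} {r d : ℝ} (hd : d ≠ 0) :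
    2 * (r * (star m * (((r / d : ℝ) : ℂ) * m)).re) - d * ‖((r / d : ℝ) : ℂ) * m‖ ^ 2 =
      r ^ 2 * ‖m‖ ^ 2 / d := by
  rw [mul_left_comm (star m), Complex.re_ofReal_mul, RCLike.star_def, ← Complex.normSq_eq_conj_mul_self,
    Complex.ofReal_re, norm_mul, Complex.norm_real, mul_pow, Real.norm_eq_abs, sq_abs,
    Complex.sq_norm]
  field_simp
  ring

lemma resolventForm_le {ρ σ : Matrix S S ℂ} (hρ : ρ.PosSemidef) (hσ : σ.PosDef) {t : ℝ}
    (ht : 0 ≤ t) (X : Matrix S S ℂ) :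
    resolventForm t ρ σ X ≤ resolventMax hρ.1 hσ.1 t := by
  have hX : X = (hσ.1.eigenvectorUnitary : Matrix S S ℂ) *
      ((hσ.1.eigenvectorUnitary : Matrix S S ℂ)ᴴ * X * hρ.1.eigenvectorUnitary) *
      (hρ.1.eigenvectorUnitary : Matrix S S ℂ)ᴴ := by
    simp only [Matrix.mul_assoc, eigenvectorUnitary_mul_conjTranspose, Matrix.mul_one]
    rw [← Matrix.mul_assoc, eigenvectorUnitary_mul_conjTranspose, Matrix.one_mul]
  rw [hX, resolventForm_spectral]
  exact Finset.sum_le_sum fun i _ => Finset.sum_le_sum fun j _ => two_mul_re_star_mul_sub_le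
    (add_pos_of_pos_of_nonneg (hσ.eigenvalues_pos i) (mul_nonneg ht (hρ.eigenvalues_nonneg j)))

lemma exists_resolventForm_eq {ρ σ : Matrix S S ℂ} (hρ : ρ.PosSemidef) (hσ : σ.PosDef) {t : ℝ}
    (ht : 0 ≤ t) : ∃ X, resolventForm t ρ σ X = resolventMax hρ.1 hσ.1 t := by
  -- The entrywise maximizers (r/d) m, with r an eigenvalue of ρ, m an overlap and d the denominator
  -- in `resolventMax`.
  refine ⟨_, (resolventForm_spectral hρ.1 hσ.1 t (Matrix.of fun i j =>
    ((hρ.1.eigenvalues j / (hσ.1.eigenvalues i + t * hρ.1.eigenvalues j) : ℝ) : ℂ) *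
      overlap hρ.1 hσ.1 i j)).trans ?_⟩
  refine Finset.sum_congr rfl fun i _ => Finset.sum_congr rfl fun j _ => ?_
  have hd := (add_pos_of_pos_of_nonneg (hσ.eigenvalues_pos i)
    (mul_nonneg ht (hρ.eigenvalues_nonneg j))).ne'
  exact two_mul_re_star_mul_sub_eq hd

/-- The relative entropy `Tr ρ (log ρ - log σ)` in natural units. -/
noncomputable def relEntropy (ρ σ : Matrix S S ℂ) : ℝ :=
  (cfc (fun x => x * Real.log x) ρ).trace.re - (ρ * cfc Real.log σ).trace.re

/-- The overlap matrix is unitary, so the squared moduli in each column sum to 1. -/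
lemma sum_overlap_left {ρ σ : Matrix S S ℂ} (hρ : ρ.IsHermitian) (hσ : σ.IsHermitian)
    (f : ℝ → ℝ) : ∑ i, ∑ j, f (hρ.eigenvalues j) * ‖overlap hρ hσ i j‖ ^ 2 =
      (cfc f ρ).trace.re := by
  have h := trace_cfc_mul_cfc hρ hσ f (fun _ => 1)
  have hσ' : IsSelfAdjoint σ := hσ
  rw [cfc_const_one ℝ σ, Matrix.mul_one] at h
  simp [h]

lemma relEntropy_eq_sum {ρ σ : Matrix S S ℂ} (hρ : ρ.IsHermitian) (hσ : σ.IsHermitian) :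
    relEntropy ρ σ = ∑ i, ∑ j, hρ.eigenvalues j * ‖overlap hρ hσ i j‖ ^ 2 *
      (Real.log (hρ.eigenvalues j) - Real.log (hσ.eigenvalues i)) := by
  have hρ' : IsSelfAdjoint ρ := hρ
  have h := trace_cfc_mul_cfc hρ hσ (fun x => x) Real.log
  rw [cfc_id' ℝ ρ] at h
  rw [relEntropy, ← sum_overlap_left hρ hσ, h]
  simp only [← Finset.sum_sub_distrib]
  exact Finset.sum_congr rfl fun i _ => Finset.sum_congr rfl fun j _ => by ring

/-- The integral of `resolventMax` over `[0, t]`. -/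
noncomputable def resolventInt {ρ σ : Matrix S S ℂ} (hρ : ρ.IsHermitian) (hσ : σ.IsHermitian)
    (t : ℝ) : ℝ :=
  ∑ i, ∑ j, hρ.eigenvalues j * ‖overlap hρ hσ i j‖ ^ 2 *
    (Real.log (hσ.eigenvalues i + t * hρ.eigenvalues j) - Real.log (hσ.eigenvalues i))

lemma hasDerivAt_resolventInt {ρ σ : Matrix S S ℂ} (hρ : ρ.PosSemidef) (hσ : σ.PosDef) {t : ℝ}
    (ht : 0 ≤ t) : HasDerivAt (resolventInt hρ.1 hσ.1) (resolventMax hρ.1 hσ.1 t) t := by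
  unfold resolventInt resolventMax
  refine HasDerivAt.fun_sum fun i _ => HasDerivAt.fun_sum fun j _ => ?_
  have hd := (add_pos_of_pos_of_nonneg (hσ.eigenvalues_pos i)
    (mul_nonneg ht (hρ.eigenvalues_nonneg j))).ne'
  have h := ((((hasDerivAt_id t).mul_const (hρ.1.eigenvalues j)).const_add
    (hσ.1.eigenvalues i)).log hd).sub_const (Real.log (hσ.1.eigenvalues i))
  refine (h.const_mul (hρ.1.eigenvalues j * ‖overlap hρ.1 hσ.1 i j‖ ^ 2)).congr_deriv ?_
  simp only [id]
  ring

-- With r, s eigenvalues of ρ and σ, log(s + t r) - log t = log(s/t + r) tends to log r when r > 0,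
-- and the weight r kills the term when r = 0. The overlaps distribute `ρ.trace.re * Real.log t`
-- over the terms.
open Filter Topology in
lemma tendsto_resolventInt {ρ σ : Matrix S S ℂ} (hρ : ρ.PosSemidef) (hσ : σ.PosDef) :
    Tendsto (fun t => resolventInt hρ.1 hσ.1 t - ρ.trace.re * Real.log t) atTop
      (𝓝 (relEntropy ρ σ)) := by
  have hρ' : IsSelfAdjoint ρ := hρ.1
  have h1 : ∀ t, resolventInt hρ.1 hσ.1 t - ρ.trace.re * Real.log t =
      ∑ i, ∑ j, hρ.1.eigenvalues j * ‖overlap hρ.1 hσ.1 i j‖ ^ 2 *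
        (Real.log (hσ.1.eigenvalues i + t * hρ.1.eigenvalues j) - Real.log (hσ.1.eigenvalues i)
          - Real.log t) := by
    intro t
    have h2 := sum_overlap_left hρ.1 hσ.1 (fun x => x)
    rw [cfc_id' ℝ ρ] at h2
    rw [← h2, resolventInt]
    simp only [Finset.sum_mul, ← Finset.sum_sub_distrib]
    exact Finset.sum_congr rfl fun i _ => Finset.sum_congr rfl fun j _ => by ring
  simp only [h1, relEntropy_eq_sum hρ.1 hσ.1]
  refine tendsto_finsetSum _ fun i _ => tendsto_finsetSum _ fun j _ => ?_
  rcases (hρ.eigenvalues_nonneg j).eq_or_lt with h | h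
  · simp [← h]
  · refine Tendsto.const_mul _ ?_
    have hs := hσ.eigenvalues_pos i
    have h3 : Tendsto (fun t : ℝ => Real.log (hσ.1.eigenvalues i / t + hρ.1.eigenvalues j)
        - Real.log (hσ.1.eigenvalues i)) atTop
        (𝓝 (Real.log (0 + hρ.1.eigenvalues j) - Real.log (hσ.1.eigenvalues i))) := by
      refine Tendsto.sub_const (Tendsto.log ?_ (by simpa using h.ne')) _
      exact (tendsto_const_nhds.div_atTop tendsto_id).add_const _
    rw [zero_add] at h3
    refine h3.congr' ?_
    filter_upwards [eventually_gt_atTop 0] with t ht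
    rw [show hσ.1.eigenvalues i + t * hρ.1.eigenvalues j =
      (hσ.1.eigenvalues i / t + hρ.1.eigenvalues j) * t by field_simp,
      Real.log_mul (by positivity) ht.ne']
    ring

end RelativeEntropy

/-! ### Passing to marginals -/

section PartialTrace

lemma trace_traceRight {S T : Type*} [Fintype S] [Fintype T] (ρ : Matrix (S × T) (S × T) ℂ) : (traceRight ρ).trace = ρ.trace := by
  simp [traceRight, Matrix.trace, Fintype.sum_prod_type]

/-- The partial trace is dual to the embedding Y ↦ Y ⊗ 1. -/
lemma trace_traceRight_mul {S T : Type*} [Fintype S] [Fintype T] [DecidableEq T]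
    (ρ : Matrix (S × T) (S × T) ℂ) (Y : Matrix S S ℂ) :
    (traceRight ρ * Y).trace = (ρ * (Y ⊗ₖ (1 : Matrix T T ℂ))).trace := by
  simp only [traceRight, Matrix.trace, Matrix.diag, Matrix.mul_apply, Matrix.of_apply,
    Fintype.sum_prod_type, Matrix.kroneckerMap_apply, Matrix.one_apply, Finset.sum_mul]
  refine Finset.sum_congr rfl fun i _ => ?_
  rw [Finset.sum_comm]
  simp

lemma traceRight_posSemidef {S T : Type*} [Fintype T] {ρ : Matrix (S × T) (S × T) ℂ} (hρ : ρ.PosSemidef) :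
    (traceRight ρ).PosSemidef := by
  have : traceRight ρ = ∑ t, ρ.submatrix (fun s => (s, t)) (fun s => (s, t)) := by
    ext i j
    simp [traceRight, Matrix.sum_apply]
  rw [this]
  exact Matrix.posSemidef_sum _ fun t _ => hρ.submatrix _

lemma traceRight_posDef {S T : Type*} [Fintype T] [Nonempty T] {ρ : Matrix (S × T) (S × T) ℂ} (hρ : ρ.PosDef) :
    (traceRight ρ).PosDef := by
  have : traceRight ρ = ∑ t, ρ.submatrix (fun s => (s, t)) (fun s => (s, t)) := by
    ext i j
    simp [traceRight, Matrix.sum_apply]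
  rw [this]
  exact Matrix.posDef_sum Finset.univ_nonempty fun t _ => hρ.submatrix
    (Prod.mk_left_injective t)

variable {S T : Type*} [Fintype S] [DecidableEq S] [Fintype T] [DecidableEq T]

/-- Y ↦ Y ⊗ 1 is multiplicative and preserves adjoints, so duality applies to the quadratic terms
too. The marginal problem is thus the original one restricted to fewer operators. -/
lemma resolventForm_traceRight {S T : Type*} [Fintype S] [Fintype T] [DecidableEq T]
    (t : ℝ) (ρ σ : Matrix (S × T) (S × T) ℂ) (Y : Matrix S S ℂ) :
    resolventForm t (traceRight ρ) (traceRight σ) Y =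
      resolventForm t ρ σ (Y ⊗ₖ (1 : Matrix T T ℂ)) := by
  simp only [resolventForm, trace_traceRight_mul, Matrix.conjTranspose_kronecker,
    Matrix.conjTranspose_one, ← Matrix.mul_kronecker_mul, Matrix.mul_one]

lemma resolventMax_traceRight_le [Nonempty T] {ρ σ : Matrix (S × T) (S × T) ℂ}
    (hρ : ρ.PosSemidef) (hσ : σ.PosDef) {t : ℝ} (ht : 0 ≤ t) :
    resolventMax (traceRight_posSemidef hρ).1 (traceRight_posDef hσ).1 t ≤
      resolventMax hρ.1 hσ.1 t := by
  obtain ⟨Y, hY⟩ := exists_resolventForm_eq (traceRight_posSemidef hρ) (traceRight_posDef hσ) ht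
  rw [← hY, resolventForm_traceRight]
  exact resolventForm_le hρ hσ ht _

lemma resolventInt_traceRight_le [Nonempty T] {ρ σ : Matrix (S × T) (S × T) ℂ}
    (hρ : ρ.PosSemidef) (hσ : σ.PosDef) {t : ℝ} (ht : 0 ≤ t) :
    resolventInt (traceRight_posSemidef hρ).1 (traceRight_posDef hσ).1 t ≤
      resolventInt hρ.1 hσ.1 t := by
  have hd : ∀ s ∈ Set.Ici (0 : ℝ), HasDerivAt (fun s => resolventInt hρ.1 hσ.1 s -
      resolventInt (traceRight_posSemidef hρ).1 (traceRight_posDef hσ).1 s)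
      (resolventMax hρ.1 hσ.1 s -
        resolventMax (traceRight_posSemidef hρ).1 (traceRight_posDef hσ).1 s) s := fun s hs =>
    (hasDerivAt_resolventInt hρ hσ hs).sub
      (hasDerivAt_resolventInt (traceRight_posSemidef hρ) (traceRight_posDef hσ) hs)
  have hm : MonotoneOn (fun s => resolventInt hρ.1 hσ.1 s -
      resolventInt (traceRight_posSemidef hρ).1 (traceRight_posDef hσ).1 s) (Set.Ici 0) := by
    refine monotoneOn_of_hasDerivWithinAt_nonneg (convex_Ici 0)
      (fun s hs => (hd s hs).continuousAt.continuousWithinAt)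
      (fun s hs => (hd s (interior_subset hs)).hasDerivWithinAt) fun s hs => ?_
    exact sub_nonneg.2 (resolventMax_traceRight_le hρ hσ (interior_subset hs))
  -- Both integrals vanish at 0 and their difference is monotone.
  have h := hm (Set.mem_Ici.2 le_rfl) (Set.mem_Ici.2 ht) ht
  simp only [resolventInt, zero_mul, add_zero, sub_self, mul_zero, Finset.sum_const_zero] at h
  simpa [resolventInt] using h

/-- The relative entropy does not increase under partial traces. -/
lemma relEntropy_traceRight_le [Nonempty T] {ρ σ : Matrix (S × T) (S × T) ℂ}
    (hρ : ρ.PosSemidef) (hσ : σ.PosDef) :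
    relEntropy (traceRight ρ) (traceRight σ) ≤ relEntropy ρ σ := by
  refine le_of_tendsto_of_tendsto (tendsto_resolventInt (traceRight_posSemidef hρ)
    (traceRight_posDef hσ)) (tendsto_resolventInt hρ hσ) ?_
  filter_upwards [Filter.eventually_ge_atTop 0] with t ht
  rw [trace_traceRight]
  exact sub_le_sub_right (resolventInt_traceRight_le hρ hσ ht) _

end PartialTrace

end PrivateDynamic

namespace PrivateDynamic

/-! ### The Holevo information does not increase under channels -/

section Holevo

variable {S T : Type*} [Fintype S] [DecidableEq S] [Fintype T] [DecidableEq T]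

lemma mul_cfc_log {ρ : Matrix S S ℂ} (hρ : ρ.IsHermitian) :
    ρ * cfc Real.log ρ = cfc (fun x => x * Real.log x) ρ := by
  have hf : ∀ f : ℝ → ℝ, ContinuousOn f (spectrum ℝ ρ) := fun f => by
    rw [continuousOn_iff_continuous_domRestrict]; fun_prop
  have hρ' : IsSelfAdjoint ρ := hρ
  conv_lhs => enter [1]; rw [← cfc_id ℝ ρ]
  rw [← cfc_mul _ _ _ (hf _) (hf _)]
  rfl

lemma trace_cfc_mul_log {ρ : Matrix S S ℂ} (hρ : ρ.IsHermitian) :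
    (cfc (fun x => x * Real.log x) ρ).trace.re = -(Real.log 2 * entropy ρ) := by
  have h2 : Real.log 2 ≠ 0 := (Real.log_pos one_lt_two).ne'
  rw [trace_cfc hρ, entropy_eq_sum hρ]
  simp only [Complex.re_sum, Complex.ofReal_re, Finset.mul_sum, ← Finset.sum_neg_distrib]
  refine Finset.sum_congr rfl fun i _ => ?_
  rw [eta, Real.negMulLog]
  field_simp

/-- The Holevo quantity is the total divergence of the members from their sum; no normalization is
needed. The factor log 2 converts bits to natural units. -/
lemma sum_relEntropy {Z : Type*} [Fintype Z] (τ : Z → Matrix S S ℂ)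
    (hτ : ∀ z, (τ z).IsHermitian) (h : (∑ z, τ z).IsHermitian) :
    ∑ z, relEntropy (τ z) (∑ z, τ z) =
      Real.log 2 * (entropy (∑ z, τ z) - ∑ z, entropy (τ z)) := by
  simp only [relEntropy, Finset.sum_sub_distrib]
  rw [← Complex.re_sum (f := fun z => (τ z * cfc Real.log (∑ z, τ z)).trace),
    ← Matrix.trace_sum, ← Finset.sum_mul, mul_cfc_log h, trace_cfc_mul_log h,
    Finset.sum_congr rfl fun z _ => trace_cfc_mul_log (hτ z), Finset.sum_neg_distrib,
    ← Finset.mul_sum]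
  ring

lemma traceRight_sum {S T Z : Type*} [Fintype T] (s : Finset Z)
    (τ : Z → Matrix (S × T) (S × T) ℂ) :
    traceRight (∑ z ∈ s, τ z) = ∑ z ∈ s, traceRight (τ z) := by
  ext i j
  simp only [traceRight, Matrix.of_apply, Matrix.sum_apply]
  exact Finset.sum_comm

lemma traceLeft_smul {S T : Type*} [Fintype S] (c : ℂ) (ρ : Matrix (S × T) (S × T) ℂ) :
    traceLeft (c • ρ) = c • traceLeft ρ := by
  ext i j
  simp [traceLeft, Finset.mul_sum]

lemma continuous_traceRight {S T : Type*} [Fintype T] :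
    Continuous (traceRight : Matrix (S × T) (S × T) ℂ → Matrix S S ℂ) :=
  continuous_matrix fun i j => continuous_finsetSum _ fun t _ =>
    continuous_id.matrix_elem (i, t) (j, t)

lemma holevo_traceRight_of_posDef [Nonempty T] {Z : Type*} [Fintype Z]
    (τ : Z → Matrix (S × T) (S × T) ℂ) (hτ : ∀ z, (τ z).PosSemidef)
    (h : (∑ z, τ z).PosDef) :
    entropy (traceRight (∑ z, τ z)) - ∑ z, entropy (traceRight (τ z)) ≤
      entropy (∑ z, τ z) - ∑ z, entropy (τ z) := by
  have h1 : ∑ z, relEntropy (traceRight (τ z)) (traceRight (∑ z, τ z)) ≤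
      ∑ z, relEntropy (τ z) (∑ z, τ z) :=
    Finset.sum_le_sum fun z _ => relEntropy_traceRight_le (hτ z) h
  have h2 := traceRight_posDef h
  rw [sum_relEntropy τ (fun z => (hτ z).1) h.1] at h1
  rw [traceRight_sum] at h1 h2 ⊢
  rw [sum_relEntropy _ (fun z => (traceRight_posSemidef (hτ z)).1) h2.1] at h1
  exact le_of_mul_le_mul_left h1 (Real.log_pos one_lt_two)

open Filter Topology in
lemma tendsto_entropy_map_add_smul_one {S R : Type*} [DecidableEq S] [Fintype R] [DecidableEq R]
    {f : Matrix S S ℂ → Matrix R R ℂ} (hf : Continuous f)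
    (hf' : ∀ ρ, ρ.PosSemidef → (f ρ).IsHermitian) (ω : Matrix S S ℂ) (hω : ω.PosSemidef) :
    Tendsto (fun ε : ℝ => entropy (f ((ε : ℂ) • (1 : Matrix S S ℂ) + ω))) (𝓝[>] 0)
      (𝓝 (entropy (f ω))) := by
  have h1 : Tendsto (fun ε : ℝ => f ((ε : ℂ) • (1 : Matrix S S ℂ) + ω))
      (𝓝[>] 0) (𝓝[{ρ | ρ.IsHermitian}] (f ω)) := by
    refine tendsto_nhdsWithin_iff.2 ⟨?_, ?_⟩
    · have h3 : Continuous (fun ε : ℝ => f ((ε : ℂ) • (1 : Matrix S S ℂ) + ω)) := by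
        fun_prop
      have h4 := (h3.tendsto 0).mono_left (nhdsWithin_le_nhds (s := Set.Ioi 0))
      simpa using h4
    · filter_upwards [self_mem_nhdsWithin] with ε hε
      exact hf' _ ((Matrix.PosDef.one.smul
        (show (0 : ℂ) < ε by exact_mod_cast hε)).posSemidef.add hω)
  exact (continuousOn_entropy (f ω) (hf' ω hω)).tendsto.comp h1

@[simp] lemma entropy_zero : entropy (0 : Matrix S S ℂ) = 0 := by simp [entropy]

open Filter Topology in
/-- The Holevo information of an ensemble of unnormalized states does not increase under partial
traces. -/
lemma holevo_traceRight [Nonempty T] {Z : Type*} [Fintype Z]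
    (τ : Z → Matrix (S × T) (S × T) ℂ) (hτ : ∀ z, (τ z).PosSemidef) :
    entropy (traceRight (∑ z, τ z)) - ∑ z, entropy (traceRight (τ z)) ≤
      entropy (∑ z, τ z) - ∑ z, entropy (τ z) := by
  have hs : (∑ z, τ z).PosSemidef := Matrix.posSemidef_sum _ fun z _ => hτ z
  -- Adjoining ε·1 to the ensemble as one more member makes the sum positive definite; its own
  -- entropy terms vanish as ε → 0.
  have key : ∀ ε : ℝ, 0 < ε →
      entropy (traceRight ((ε : ℂ) • (1 : Matrix (S × T) (S × T) ℂ) + ∑ z, τ z)) -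
        (entropy (traceRight ((ε : ℂ) • (1 : Matrix (S × T) (S × T) ℂ))) +
          ∑ z, entropy (traceRight (τ z))) ≤
      entropy ((ε : ℂ) • (1 : Matrix (S × T) (S × T) ℂ) + ∑ z, τ z) -
        (entropy ((ε : ℂ) • (1 : Matrix (S × T) (S × T) ℂ)) + ∑ z, entropy (τ z)) := by
    intro ε hε
    have hε1 : ((ε : ℂ) • (1 : Matrix (S × T) (S × T) ℂ)).PosDef :=
      Matrix.PosDef.one.smul (by exact_mod_cast hε)
    have h := holevo_traceRight_of_posDef
      (fun o : Option Z => o.elim ((ε : ℂ) • (1 : Matrix (S × T) (S × T) ℂ)) τ)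
      (by rintro (_ | z); exacts [hε1.posSemidef, hτ z])
      (by
        rw [Fintype.sum_option]
        exact hε1.add_posSemidef hs)
    simpa only [Fintype.sum_option, Option.elim] using h
  have hr := @tendsto_entropy_map_add_smul_one (S × T) S _ _ _ _ continuous_traceRight
    (fun ρ hρ => (traceRight_posSemidef hρ).1)
  have hi := @tendsto_entropy_map_add_smul_one (S × T) (S × T) _ _ _ _ continuous_id
    (fun ρ hρ => hρ.1)
  have z0 : (0 : Matrix (S × T) (S × T) ℂ).PosSemidef := Matrix.PosSemidef.zero
  have t0 : traceRight (0 : Matrix (S × T) (S × T) ℂ) = 0 := by ext; simp [traceRight]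
  have hr0 := hr 0 z0
  have hi0 := hi 0 z0
  simp only [t0, entropy_zero, add_zero, id] at hr0 hi0
  have L := (hr _ hs).sub (hr0.add_const (∑ z, entropy (traceRight (τ z))))
  have R := (hi _ hs).sub (hi0.add_const (∑ z, entropy (τ z)))
  rw [zero_add] at L R
  refine le_of_tendsto_of_tendsto L R ?_
  filter_upwards [self_mem_nhdsWithin] with ε hε
  exact key ε hε

lemma entropy_submatrix_equiv {R : Type*} [Fintype R] [DecidableEq R] {ρ : Matrix S S ℂ}
    (hρ : ρ.IsHermitian) (e : R ≃ S) : entropy (ρ.submatrix e e) = entropy ρ := by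
  have h := Matrix.charpoly_reindex e.symm ρ
  rw [Matrix.reindex_apply, Equiv.symm_symm] at h
  rw [entropy_eq_roots hρ, entropy_eq_roots (hρ.submatrix e), h]

lemma holevo_traceLeft [Nonempty S] {Z : Type*} [Fintype Z]
    (τ : Z → Matrix (S × T) (S × T) ℂ) (hτ : ∀ z, (τ z).PosSemidef) :
    entropy (traceLeft (∑ z, τ z)) - ∑ z, entropy (traceLeft (τ z)) ≤
      entropy (∑ z, τ z) - ∑ z, entropy (τ z) := by
  have hs : (∑ z, τ z).PosSemidef := Matrix.posSemidef_sum _ fun z _ => hτ z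
  have h := holevo_traceRight
    (fun z => (τ z).submatrix (Equiv.prodComm T S) (Equiv.prodComm T S))
    (fun z => (hτ z).submatrix _)
  have h1 : ∑ z, (τ z).submatrix (Equiv.prodComm T S) (Equiv.prodComm T S) =
      (∑ z, τ z).submatrix (Equiv.prodComm T S) (Equiv.prodComm T S) := by
    ext; simp [Matrix.sum_apply]
  rw [h1, entropy_submatrix_equiv hs.1] at h
  simp only [entropy_submatrix_equiv (hτ _).1] at h
  exact h

end Holevo

/-! ### Isometric extensions, complementary outputs and degradability -/

section Isometry

lemma exists_mul_conjTranspose {S : Type*} [Fintype S] {ρ : Matrix S S ℂ}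
    (hρ : ρ.PosSemidef) : ∃ C : Matrix S S ℂ, ρ = C * Cᴴ := by
  classical
  open scoped MatrixOrder in
  obtain ⟨C, hC⟩ := CStarAlgebra.nonneg_iff_eq_star_mul_self.1 hρ.nonneg
  exact ⟨Cᴴ, by rw [Matrix.conjTranspose_conjTranspose]; exact hC⟩

variable {A B E : Type*} [Fintype A] [DecidableEq A] [Fintype B] [DecidableEq B] [Fintype E]
  [DecidableEq E]

lemma entropy_isometry {V : Matrix B A ℂ} (hV : Vᴴ * V = 1) {ρ : Matrix A A ℂ}
    (hρ : ρ.PosSemidef) : entropy (V * ρ * Vᴴ) = entropy ρ := by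
  obtain ⟨C, rfl⟩ := exists_mul_conjTranspose hρ
  have h1 : V * (C * Cᴴ) * Vᴴ = (V * C) * (V * C)ᴴ := by
    simp only [Matrix.conjTranspose_mul, Matrix.mul_assoc]
  have h2 : (V * C)ᴴ * (V * C) = Cᴴ * C := by
    rw [Matrix.conjTranspose_mul, Matrix.mul_assoc, ← Matrix.mul_assoc Vᴴ, hV, Matrix.one_mul]
  rw [h1, entropy_mul_conjTranspose, h2, entropy_mul_conjTranspose]

/-- The two marginals of a pure state have the same entropy. -/
lemma entropy_traceLeft_vecMulVec (w : B × E → ℂ) :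
    entropy (traceLeft (Matrix.vecMulVec w (star w))) =
      entropy (traceRight (Matrix.vecMulVec w (star w))) := by
  set M : Matrix B E ℂ := Matrix.of fun b e => w (b, e)
  have h1 : traceRight (Matrix.vecMulVec w (star w)) = M * Mᴴ := by
    ext i j
    simp [traceRight, Matrix.vecMulVec_apply, Matrix.mul_apply, M]
  have h2 : traceLeft (Matrix.vecMulVec w (star w)) = (Mᴴ * M)ᵀ := by
    ext i j
    simp [traceLeft, Matrix.vecMulVec_apply, Matrix.mul_apply, M, mul_comm]
  rw [h1, h2, entropy_transpose (Matrix.isHermitian_conjTranspose_mul_self M),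
    entropy_mul_conjTranspose]

/-- The entries of V C are the amplitudes of a vector on B ⊗ E ⊗ A. Its marginals on E and on B ⊗ A
have equal entropy, and the latter is determined by N and C alone. -/
lemma entropy_complement_eq_entropy_extension {N : Matrix A A ℂ →ₗ[ℂ] Matrix B B ℂ}
    {V : Matrix (B × E) A ℂ} (hV : IsIsometricExtension N V) (C : Matrix A A ℂ) :
    entropy (traceLeft (V * (C * Cᴴ) * Vᴴ)) = entropy (Matrix.of fun i j : B × A =>
      N (C * Matrix.single i.2 j.2 (1 : ℂ) * Cᴴ) i.1 j.1) := by
  set M : Matrix (B × A) E ℂ := Matrix.of fun i e => (V * C) (i.1, e) i.2 with hM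
  have h1 : (Matrix.of fun i j : B × A =>
      N (C * Matrix.single i.2 j.2 (1 : ℂ) * Cᴴ) i.1 j.1) = M * Mᴴ := by
    ext ⟨b, a⟩ ⟨b', a'⟩
    have h2 : V * (C * Matrix.single a a' (1 : ℂ) * Cᴴ) * Vᴴ =
        (V * C) * Matrix.single a a' (1 : ℂ) * (V * C)ᴴ := by
      simp only [Matrix.conjTranspose_mul, Matrix.mul_assoc]
    rw [Matrix.of_apply, hV.2, h2, Matrix.mul_apply (M := M)]
    refine Finset.sum_congr rfl fun e _ => ?_
    rw [Matrix.mul_assoc, Matrix.mul_apply, Finset.sum_eq_single a]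
    · rw [Matrix.single_mul_apply_same, one_mul]
      rfl
    · intro c _ hc
      rw [Matrix.single_mul_apply_of_ne _ _ _ _ _ hc, mul_zero]
    · simp
  have h3 : traceLeft (V * (C * Cᴴ) * Vᴴ) = (Mᴴ * M)ᵀ := by
    have h4 : V * (C * Cᴴ) * Vᴴ = (V * C) * (V * C)ᴴ := by
      simp only [Matrix.conjTranspose_mul, Matrix.mul_assoc]
    ext i j
    rw [h4]
    rw [Matrix.transpose_apply, Matrix.mul_apply (M := Mᴴ), Fintype.sum_prod_type, traceLeft,
      Matrix.of_apply]
    refine Finset.sum_congr rfl fun b _ => ?_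
    rw [Matrix.mul_apply (M := V * C)]
    exact Finset.sum_congr rfl fun a _ => mul_comm _ _
  rw [h1, h3, entropy_transpose (Matrix.isHermitian_conjTranspose_mul_self M),
    entropy_mul_conjTranspose]

/-- The entropy of the output of the complementary channel does not depend on the isometric
extension. -/
lemma entropy_complement_eq {E' : Type*} [Fintype E'] [DecidableEq E']
    {N : Matrix A A ℂ →ₗ[ℂ] Matrix B B ℂ} {V : Matrix (B × E) A ℂ} {V' : Matrix (B × E') A ℂ}
    (hV : IsIsometricExtension N V) (hV' : IsIsometricExtension N V') {ρ : Matrix A A ℂ}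
    (hρ : ρ.PosSemidef) :
    entropy (traceLeft (V * ρ * Vᴴ)) = entropy (traceLeft (V' * ρ * V'ᴴ)) := by
  obtain ⟨C, rfl⟩ := exists_mul_conjTranspose hρ
  rw [entropy_complement_eq_entropy_extension hV, entropy_complement_eq_entropy_extension hV']

lemma traceLeft_posSemidef {S T : Type*} [Fintype S] {ρ : Matrix (S × T) (S × T) ℂ}
    (hρ : ρ.PosSemidef) : (traceLeft ρ).PosSemidef := by
  have : traceLeft ρ = ∑ s, ρ.submatrix (fun t => (s, t)) (fun t => (s, t)) := by
    ext i j
    simp [traceLeft, Matrix.sum_apply]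
  rw [this]
  exact Matrix.posSemidef_sum _ fun t _ => hρ.submatrix _

/-- Stinespring: stack the Kraus operators, the environment being their index. -/
lemma IsChannel.exists_isIsometricExtension {A B : Type*} [Fintype A] [DecidableEq A] [Fintype B]
    {N : Matrix A A ℂ →ₗ[ℂ] Matrix B B ℂ} (hN : IsChannel N) :
    ∃ (k : ℕ) (V : Matrix (B × Fin k) A ℂ), IsIsometricExtension N V := by
  obtain ⟨k, K, hK, h1⟩ := hN
  refine ⟨k, Matrix.of fun i a => K i.2 i.1 a, ?_, fun ρ => ?_⟩
  · rw [← h1]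
    ext a a'
    simp [Matrix.mul_apply, Matrix.sum_apply, Fintype.sum_prod_type_right]
  · rw [hK]
    ext b b'
    simp [traceRight, Matrix.mul_apply, Matrix.sum_apply]

/-- The Holevo information does not increase under channels. -/
lemma holevo_channel [Nonempty B] {D : Matrix B B ℂ →ₗ[ℂ] Matrix E E ℂ} (hD : IsChannel D)
    {Z : Type*} [Fintype Z] (τ : Z → Matrix B B ℂ) (hτ : ∀ z, (τ z).PosSemidef) :
    entropy (D (∑ z, τ z)) - ∑ z, entropy (D (τ z)) ≤
      entropy (∑ z, τ z) - ∑ z, entropy (τ z) := by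
  obtain ⟨k, W, hW⟩ := hD.exists_isIsometricExtension
  have hk : Nonempty (Fin k) := by
    by_contra h
    have : IsEmpty (Fin k) := not_nonempty_iff.1 h
    have h0 := hW.1
    obtain ⟨b⟩ := ‹Nonempty B›
    have h1 := congrFun (congrFun h0 b) b
    simp [Matrix.mul_apply] at h1
  have hs : (∑ z, τ z).PosSemidef := Matrix.posSemidef_sum _ fun z _ => hτ z
  have h := holevo_traceRight (fun z => W * τ z * Wᴴ)
    (fun z => (hτ z).mul_mul_conjTranspose_same W)
  rw [← Matrix.sum_mul, ← Matrix.mul_sum, entropy_isometry hW.1 hs] at h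
  simp only [entropy_isometry hW.1 (hτ _), ← hW.2] at h
  exact h

lemma IsIsometricExtension.posSemidef {A B E : Type*} [Fintype A] [DecidableEq A] [Fintype B]
    [Fintype E] {N : Matrix A A ℂ →ₗ[ℂ] Matrix B B ℂ} {V : Matrix (B × E) A ℂ}
    (hV : IsIsometricExtension N V) {ρ : Matrix A A ℂ} (hρ : ρ.PosSemidef) :
    (N ρ).PosSemidef := by
  rw [hV.2]
  exact traceRight_posSemidef (hρ.mul_mul_conjTranspose_same V)

/-- At trace zero the operator vanishes and any density operator serves; that one exists needs
`Nonempty A`. -/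
lemma eq_trace_smul_isDensity {ρ : Matrix A A ℂ} [Nonempty A] (hρ : ρ.PosSemidef) :
    ∃ ω : Matrix A A ℂ, IsDensity ω ∧ ρ = ((ρ.trace.re : ℝ) : ℂ) • ω := by
  have h0 : (0 : ℂ) ≤ ρ.trace := hρ.trace_nonneg
  have h1 : ((ρ.trace.re : ℝ) : ℂ) = ρ.trace := by
    rw [Complex.le_def] at h0
    apply Complex.ext <;> simp [← h0.2]
  by_cases h : ρ.trace = 0
  · obtain ⟨a⟩ := ‹Nonempty A›
    refine ⟨Matrix.single a a 1, ⟨?_, by simp⟩, ?_⟩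
    · rw [← Matrix.diagonal_single]
      exact Matrix.PosSemidef.diagonal (by
        intro i; by_cases h : i = a <;> simp [h])
    · rw [h1, h, zero_smul]
      exact hρ.trace_eq_zero_iff.1 h
  · refine ⟨(ρ.trace)⁻¹ • ρ, ⟨hρ.smul (inv_nonneg.2 h0), ?_⟩, ?_⟩
    · rw [Matrix.trace_smul, smul_eq_mul, inv_mul_cancel₀ h]
    · rw [h1, smul_smul, mul_inv_cancel₀ h, one_smul]

lemma mul_single_mul_conjTranspose (C : Matrix A A ℂ) (a : A) :
    C * Matrix.single a a (1 : ℂ) * Cᴴ =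
      Matrix.vecMulVec (fun i => C i a) (star fun i => C i a) := by
  ext i j
  rw [Matrix.mul_assoc, Matrix.mul_apply, Finset.sum_eq_single a]
  · rw [Matrix.single_mul_apply_same, one_mul]
    rfl
  · intro c _ hc
    rw [Matrix.single_mul_apply_of_ne _ _ _ _ _ hc, mul_zero]
  · simp

lemma IsIsometricExtension.nonempty {A B E : Type*} [Fintype A] [DecidableEq A] [Fintype B]
    [Fintype E] [Nonempty A] {N : Matrix A A ℂ →ₗ[ℂ] Matrix B B ℂ} {V : Matrix (B × E) A ℂ}
    (hV : IsIsometricExtension N V) : Nonempty B ∧ Nonempty E := by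
  rw [← nonempty_prod]
  by_contra h
  have : IsEmpty (B × E) := not_nonempty_iff.1 h
  obtain ⟨a⟩ := ‹Nonempty A›
  have h1 := congrFun (congrFun hV.1 a) a
  simp [Matrix.mul_apply] at h1

/-- For a degradable channel the coherent information is nonnegative. -/
lemma entropy_complement_le [Nonempty A] {N : Matrix A A ℂ →ₗ[ℂ] Matrix B B ℂ}
    (hdeg : IsDegradable N) {V : Matrix (B × E) A ℂ} (hV : IsIsometricExtension N V)
    {ρ : Matrix A A ℂ} (hρ : ρ.PosSemidef) :
    entropy (traceLeft (V * ρ * Vᴴ)) ≤ entropy (N ρ) := by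
  classical
  obtain ⟨F, _, W, D, hW, hD, hDN⟩ := hdeg
  have : Nonempty B := hW.nonempty.1
  rw [entropy_complement_eq hV hW hρ]
  -- Degradability is given on states; homogeneity extends it to unnormalized inputs.
  have hD' : ∀ τ : Matrix A A ℂ, τ.PosSemidef → D (N τ) = traceLeft (W * τ * Wᴴ) := by
    intro τ hτ
    obtain ⟨ω, hω, h⟩ := eq_trace_smul_isDensity hτ
    rw [h, map_smul, map_smul, hDN ω hω, Matrix.mul_smul, Matrix.smul_mul, traceLeft_smul]
  obtain ⟨C, hC⟩ := exists_mul_conjTranspose hρ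
  -- The columns of C split ρ into rank-one pieces.
  set ψ : A → Matrix A A ℂ := fun a => C * Matrix.single a a (1 : ℂ) * Cᴴ with hψ
  have hψ0 : ∀ a, ψ a = Matrix.vecMulVec (fun i => C i a) (star fun i => C i a) :=
    mul_single_mul_conjTranspose C
  have hψ1 : ∀ a, (ψ a).PosSemidef := fun a => by
    rw [hψ0]; exact Matrix.posSemidef_vecMulVec_self_star _
  have hψ2 : ∑ a, ψ a = ρ := by
    rw [hψ, ← Finset.sum_mul, ← Finset.mul_sum, Matrix.sum_single_one, Matrix.mul_one, hC]
  have h := holevo_channel hD (fun a => N (ψ a)) (fun a => hW.posSemidef (hψ1 a))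
  rw [← map_sum, hψ2, hD' ρ hρ] at h
  -- The isometry keeps a pure input pure on B ⊗ F, so both marginals have the same entropy and
  -- these sums cancel in `h`.
  have h2 : ∀ a, entropy (D (N (ψ a))) = entropy (N (ψ a)) := by
    intro a
    have h3 : W * ψ a * Wᴴ = Matrix.vecMulVec (W *ᵥ fun i => C i a)
        (star (W *ᵥ fun i => C i a)) := by
      rw [hψ0, Matrix.mul_vecMulVec, Matrix.vecMulVec_mul, Matrix.star_mulVec]
    rw [hD' _ (hψ1 a), hW.2, h3, entropy_traceLeft_vecMulVec]
  simp only [h2] at h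
  linarith

/-- The Holevo information of the outputs of the complementary channel is at most that of the
inputs. -/
lemma holevo_complement [Nonempty A] {N : Matrix A A ℂ →ₗ[ℂ] Matrix B B ℂ}
    {V : Matrix (B × E) A ℂ} (hV : IsIsometricExtension N V) {Z : Type*} [Fintype Z]
    (τ : Z → Matrix A A ℂ) (hτ : ∀ z, (τ z).PosSemidef) :
    entropy (traceLeft (V * (∑ z, τ z) * Vᴴ)) - ∑ z, entropy (traceLeft (V * τ z * Vᴴ)) ≤
      entropy (∑ z, τ z) - ∑ z, entropy (τ z) := by
  have : Nonempty B := hV.nonempty.1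
  have hs : (∑ z, τ z).PosSemidef := Matrix.posSemidef_sum _ fun z _ => hτ z
  have h := holevo_traceLeft (fun z => V * τ z * Vᴴ)
    (fun z => (hτ z).mul_mul_conjTranspose_same V)
  rw [← Matrix.sum_mul, ← Matrix.mul_sum, entropy_isometry hV.1 hs] at h
  simp only [entropy_isometry hV.1 (hτ _)] at h
  exact h

end Isometry

end PrivateDynamic

namespace PrivateDynamic

/-! ### The objectives as functions of the ensemble -/

/-- The degree-one homogeneous extension of the entropy of a density operator. -/
noncomputable def nent {S : Type*} [Fintype S] [DecidableEq S] (τ : Matrix S S ℂ) : ℝ :=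
  entropy τ - eta τ.trace.re

lemma nent_smul {S : Type*} [Fintype S] [DecidableEq S] {τ : Matrix S S ℂ}
    (hτ : τ.IsHermitian) (c : ℝ) : nent ((c : ℂ) • τ) = c * nent τ := by
  rw [nent, nent, entropy_smul hτ, Matrix.trace_smul, smul_eq_mul, Complex.re_ofReal_mul, eta_mul]
  ring

lemma IsHermitian.coe_re_trace {S : Type*} [Fintype S] {τ : Matrix S S ℂ}
    (hτ : τ.IsHermitian) : (τ.trace.re : ℂ) = τ.trace := by
  apply Complex.conj_eq_iff_re.1
  rw [starRingEnd_apply, ← Matrix.trace_conjTranspose, hτ.eq]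

/-! ### Information quantities of classical-quantum states -/

section Blocks

variable {X Y S K : Type*} [Fintype X] [DecidableEq X] [Fintype Y] [DecidableEq Y] [Fintype S]
  [DecidableEq S] [Fintype K] [DecidableEq K]

lemma entropy_of_blocks_right (τ : X → Matrix S S ℂ) (hτ : ∀ x, (τ x).IsHermitian)
    (σ : Matrix (S × X) (S × X) ℂ)
    (hσ : ∀ s x s' x', σ (s, x) (s', x') = if x = x' then τ x s s' else 0) :
    entropy σ = ∑ x, entropy (τ x) :=
  entropy_of_blocks (Equiv.refl _) τ hτ σ fun i j => hσ i.1 i.2 j.1 j.2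

lemma entropy_of_traces (τ : K → Matrix S S ℂ) (hτ : ∀ k, (τ k).IsHermitian)
    (σ : Matrix K K ℂ) (hσ : ∀ k k', σ k k' = if k = k' then (τ k).trace else 0) :
    entropy σ = ∑ k, eta (τ k).trace.re := by
  rw [← entropy_diagonal]
  congr 1
  ext k k'
  rw [hσ, Matrix.diagonal_apply]
  by_cases h : k = k'
  · simp [h, IsHermitian.coe_re_trace (hτ k')]
  · simp [h]

/-- The register's entropy ∑ η(Tr τ_k) combines with the block entropies into the `nent` terms. -/
lemma mutualInfo_of_blocks (τ : K → Matrix S S ℂ) (hτ : ∀ k, (τ k).IsHermitian)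
    (σ : Matrix (K × S) (K × S) ℂ)
    (hσ : ∀ k s k' s', σ (k, s) (k', s') = if k = k' then τ k s s' else 0) :
    mutualInfo σ = entropy (∑ k, τ k) - ∑ k, nent (τ k) := by
  have h1 : entropy (traceRight σ) = ∑ k, eta (τ k).trace.re := by
    refine entropy_of_traces τ hτ _ fun k k' => ?_
    simp only [traceRight, Matrix.of_apply, hσ]
    by_cases h : k = k' <;> simp [h, Matrix.trace]
  have h2 : traceLeft σ = ∑ k, τ k := by
    ext s s'
    simp [traceLeft, hσ, Matrix.sum_apply]
  have h3 : entropy σ = ∑ k, entropy (τ k) :=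
    entropy_of_blocks (Equiv.prodComm K S) τ hτ σ fun i j => hσ i.1 i.2 j.1 j.2
  simp only [mutualInfo, h1, h2, h3, nent, Finset.sum_sub_distrib]
  ring

lemma isHermitian_sum {Z S : Type*} (s : Finset Z) {τ : Z → Matrix S S ℂ}
    (hτ : ∀ z, (τ z).IsHermitian) : (∑ z ∈ s, τ z).IsHermitian := by
  rw [Matrix.IsHermitian, Matrix.conjTranspose_sum]
  exact Finset.sum_congr rfl fun z _ => hτ z

lemma condMutualInfo_of_blocks (τ : X → Y → Matrix S S ℂ) (hτ : ∀ x y, (τ x y).IsHermitian)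
    (σ : Matrix (Y × S × X) (Y × S × X) ℂ)
    (hσ : ∀ y s x y' s' x', σ (y, s, x) (y', s', x') =
      if x = x' ∧ y = y' then τ x y s s' else 0) :
    condMutualInfo σ = ∑ x, nent (∑ y, τ x y) - ∑ x, ∑ y, nent (τ x y) := by
  have hs : ∀ x, (∑ y, τ x y).IsHermitian := fun x => isHermitian_sum _ (hτ x)
  have h1 : entropy (traceMid σ) = ∑ x, ∑ y, eta (τ x y).trace.re := by
    rw [entropy_of_traces (fun k : Y × X => τ k.2 k.1) (fun k => hτ _ _)]
    · exact Fintype.sum_prod_type_right _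
    · rintro ⟨y, x⟩ ⟨y', x'⟩
      simp only [traceMid, Matrix.of_apply, hσ, Prod.mk.injEq, and_comm (a := x = x')]
      by_cases h : y = y' ∧ x = x'
      · simp [h, Matrix.trace]
      · simp [h]
  have h2 : ∀ s x s' x', traceLeft σ (s, x) (s', x') =
      if x = x' then (∑ y, τ x y) s s' else 0 := by
    intro s x s' x'
    simp only [traceLeft, Matrix.of_apply, hσ, Matrix.sum_apply]
    by_cases h : x = x' <;> simp [h]
  have h3 : entropy (traceLeft (traceLeft σ)) = ∑ x, eta (∑ y, τ x y).trace.re := by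
    refine entropy_of_traces _ hs _ fun x x' => ?_
    simp only [traceLeft.eq_1 (traceLeft σ), Matrix.of_apply, h2]
    by_cases h : x = x' <;> simp [h, Matrix.trace]
  have h4 : entropy σ = ∑ x, ∑ y, entropy (τ x y) := by
    rw [← Fintype.sum_prod_type' (f := fun x y => entropy (τ x y))]
    let e : Y × S × X ≃ S × X × Y :=
      { toFun := fun i => (i.2.1, i.2.2, i.1)
        invFun := fun i => (i.2.2, i.1, i.2.1)
        left_inv := fun _ => rfl
        right_inv := fun _ => rfl }
    refine entropy_of_blocks e (fun k => τ k.1 k.2) (fun k => hτ _ _) σ ?_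
    rintro ⟨y, s, x⟩ ⟨y', s', x'⟩
    rw [hσ]
    simp [e]
  simp only [condMutualInfo, h1, entropy_of_blocks_right _ hs _ h2, h3, h4, nent,
    Finset.sum_sub_distrib]
  ring

end Blocks

/-! ### The private objective -/

section Private

variable {A B E X Y : Type*} [Fintype A] [DecidableEq A] [Fintype B] [DecidableEq B] [Fintype E]
  [DecidableEq E] [Fintype X] [DecidableEq X] [Fintype Y] [DecidableEq Y]

/-- The complementary channel of the isometric extension `V`. -/
noncomputable def complement (V : Matrix (B × E) A ℂ) : Matrix A A ℂ →ₗ[ℂ] Matrix E E ℂ where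
  toFun ρ := traceLeft (V * ρ * Vᴴ)
  map_add' ρ τ := by
    ext
    simp [traceLeft, Matrix.mul_add, Matrix.add_mul, Finset.sum_add_distrib]
  map_smul' c ρ := by
    rw [Matrix.mul_smul, Matrix.smul_mul, traceLeft_smul]
    rfl

lemma complement_apply {A B E : Type*} [Fintype A] [Fintype B] (V : Matrix (B × E) A ℂ)
    (ρ : Matrix A A ℂ) : complement V ρ = traceLeft (V * ρ * Vᴴ) := rfl

lemma complement_posSemidef {A B E : Type*} [Fintype A] [Fintype B] [Fintype E]
    (V : Matrix (B × E) A ℂ) {ρ : Matrix A A ℂ} (hρ : ρ.PosSemidef) :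
    (complement V ρ).PosSemidef :=
  traceLeft_posSemidef (hρ.mul_mul_conjTranspose_same V)

lemma privateState_apply (V : Matrix (B × E) A ℂ) (p : X → Y → ℝ) (ρ : X → Y → Matrix A A ℂ)
    (x x' : X) (y y' : Y) (s s' : B × E) :
    privateState V p ρ (x, y, s) (x', y', s') =
      if x = x' ∧ y = y' then (V * ((p x y : ℂ) • ρ x y) * Vᴴ) s s' else 0 := by
  simp only [privateState, Matrix.sum_apply, Matrix.smul_apply, Matrix.kroneckerMap_apply,
    Matrix.single_apply, smul_eq_mul]
  rw [Finset.sum_eq_single x, Finset.sum_eq_single y]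
  · by_cases h : x = x' <;> by_cases h' : y = y' <;> simp [h, h']
  · intro b _ hb; simp [hb]
  · simp
  · intro b _ hb; simp [hb]
  · simp

/-- The private dynamic objective in terms of the ensemble of unnormalized inputs `τ x y`. -/
noncomputable def privateForm (N : Matrix A A ℂ →ₗ[ℂ] Matrix B B ℂ)
    (M : Matrix A A ℂ →ₗ[ℂ] Matrix E E ℂ) (lam mu : ℝ) (τ : X → Y → Matrix A A ℂ) : ℝ :=
  (1 + mu) * entropy (N (∑ x, ∑ y, τ x y)) +
    ∑ x, (lam * nent (N (∑ y, τ x y)) - (lam + mu) * nent (M (∑ y, τ x y))) +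
    ∑ x, ∑ y, ((lam + mu) * nent (M (τ x y)) - (1 + lam + mu) * nent (N (τ x y)))

lemma privateObjective_eq {N : Matrix A A ℂ →ₗ[ℂ] Matrix B B ℂ} {V : Matrix (B × E) A ℂ}
    (hV : IsIsometricExtension N V) (lam mu : ℝ) {p : X → Y → ℝ} {ρ : X → Y → Matrix A A ℂ}
    (hτ : ∀ x y, ((p x y : ℂ) • ρ x y).PosSemidef) :
    privateObjective lam mu (privateState V p ρ) =
      privateForm N (complement V) lam mu fun x y => (p x y : ℂ) • ρ x y := by
  have hN : ∀ x y, (N ((p x y : ℂ) • ρ x y)).IsHermitian := fun x y => (hV.posSemidef (hτ x y)).1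
  have hM : ∀ x y, (complement V ((p x y : ℂ) • ρ x y)).IsHermitian := fun x y =>
    (complement_posSemidef V (hτ x y)).1
  have h1 : mutualInfo (Matrix.of fun i j : (Y × X) × B =>
      ∑ e, privateState V p ρ (i.1.2, i.1.1, i.2, e) (j.1.2, j.1.1, j.2, e)) =
      entropy (N (∑ x, ∑ y, (p x y : ℂ) • ρ x y)) -
        ∑ x, ∑ y, nent (N ((p x y : ℂ) • ρ x y)) := by
    rw [mutualInfo_of_blocks (fun k : Y × X => N ((p k.2 k.1 : ℂ) • ρ k.2 k.1)) fun k => hN _ _]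
    · simp only [Fintype.sum_prod_type_right, map_sum]
    · rintro ⟨y, x⟩ b ⟨y', x'⟩ b'
      simp only [Matrix.of_apply, privateState_apply, hV.2, traceRight, Prod.mk.injEq,
        and_comm (a := x = x')]
      by_cases h : y = y' ∧ x = x'
      · simp only [h, and_self, if_true]
      · simp [h]
  have h2 := condMutualInfo_of_blocks (fun x y => N ((p x y : ℂ) • ρ x y)) hN
    (Matrix.of fun i j : Y × B × X =>
      ∑ e, privateState V p ρ (i.2.2, i.1, i.2.1, e) (j.2.2, j.1, j.2.1, e)) (by
      intro y b x y' b' x'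
      simp only [Matrix.of_apply, privateState_apply, hV.2, traceRight]
      by_cases h : x = x' ∧ y = y'
      · simp only [h, and_self, if_true]
      · simp [h])
  have h3 := condMutualInfo_of_blocks (fun x y => complement V ((p x y : ℂ) • ρ x y)) hM
    (Matrix.of fun i j : Y × E × X =>
      ∑ b, privateState V p ρ (i.2.2, i.1, b, i.2.1) (j.2.2, j.1, b, j.2.1)) (by
      intro y b x y' b' x'
      simp only [Matrix.of_apply, privateState_apply, complement_apply, traceLeft]
      by_cases h : x = x' ∧ y = y'
      · simp only [h, and_self, if_true]
      · simp [h])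
  simp only [privateObjective, h1, h2, h3, privateForm, map_sum, Finset.sum_sub_distrib,
    ← Finset.mul_sum]
  ring

end Private

/-! ### The quantum objective -/

section Quantum

variable {A B E X R : Type*} [Fintype A] [DecidableEq A] [Fintype B] [DecidableEq B] [Fintype E]
  [DecidableEq E] [Fintype X] [DecidableEq X] [Fintype R] [DecidableEq R]

/-- The quantum dynamic objective in terms of the ensemble of unnormalized inputs `τ x`. -/
noncomputable def quantumForm (N : Matrix A A ℂ →ₗ[ℂ] Matrix B B ℂ)
    (M : Matrix A A ℂ →ₗ[ℂ] Matrix E E ℂ) (lam mu : ℝ) (τ : X → Matrix A A ℂ) : ℝ :=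
  (1 + mu) * entropy (N (∑ x, τ x)) +
    ∑ x, (nent (τ x) + lam * nent (N (τ x)) - (1 + lam + mu) * nent (M (τ x)))

/-- The input operator of the channel when the sender prepares the vector `φ`. -/
noncomputable def inputState (φ : R × A → ℂ) : Matrix A A ℂ :=
  traceLeft (Matrix.vecMulVec φ (star φ))

/-- The output on `R ⊗ B` when the sender prepares the vector `φ`. -/
noncomputable def outputState (V : Matrix (B × E) A ℂ) (φ : R × A → ℂ) :
    Matrix (R × B) (R × B) ℂ :=
  Matrix.of fun i j => ∑ e, (((1 : Matrix R R ℂ) ⊗ₖ V) *ᵥ φ) (i.1, i.2, e) *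
    star ((((1 : Matrix R R ℂ) ⊗ₖ V) *ᵥ φ) (j.1, j.2, e))

lemma inputState_posSemidef {A R : Type*} [Fintype A] [Fintype R] (φ : R × A → ℂ) :
    (inputState φ).PosSemidef :=
  traceLeft_posSemidef (Matrix.posSemidef_vecMulVec_self_star φ)

lemma inputState_eq {A R : Type*} [Fintype R] (φ : R × A → ℂ) :
    inputState φ = ((Matrix.of fun r a => φ (r, a))ᴴ * Matrix.of fun r a => φ (r, a))ᵀ := by
  ext a a'
  simp [inputState, traceLeft, Matrix.vecMulVec_apply, Matrix.mul_apply, mul_comm]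

lemma kronecker_mulVec_apply {A R K : Type*} [Fintype A] [Fintype R] [DecidableEq R]
    (V : Matrix K A ℂ) (φ : R × A → ℂ) (r : R) (k : K) :
    (((1 : Matrix R R ℂ) ⊗ₖ V) *ᵥ φ) (r, k) =
      ((Matrix.of fun r a => φ (r, a)) * Vᵀ : Matrix R K ℂ) r k := by
  simp only [Matrix.mulVec, dotProduct, Matrix.mul_apply, Fintype.sum_prod_type,
    Matrix.kroneckerMap_apply, Matrix.one_apply]
  rw [Finset.sum_eq_single r]
  · simp [mul_comm]
  · intro b _ hb; simp [hb.symm]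
  · simp

lemma isometry_mul_inputState {A R K : Type*} [Fintype A] [Fintype R]
    (V : Matrix K A ℂ) (φ : R × A → ℂ) :
    V * inputState φ * Vᴴ = (((Matrix.of fun r a => φ (r, a)) * Vᵀ : Matrix R K ℂ)ᴴ *
      ((Matrix.of fun r a => φ (r, a)) * Vᵀ : Matrix R K ℂ))ᵀ := by
  rw [inputState_eq]
  simp only [Matrix.conjTranspose_mul, Matrix.transpose_mul, Matrix.transpose_transpose,
    Matrix.mul_assoc]
  rfl

lemma outputState_posSemidef (V : Matrix (B × E) A ℂ) (φ : R × A → ℂ) :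
    (outputState V φ).PosSemidef := by
  have h : outputState V φ = (Matrix.of fun (i : R × B) e =>
      (((1 : Matrix R R ℂ) ⊗ₖ V) *ᵥ φ) (i.1, i.2, e)) * (Matrix.of fun (i : R × B) e =>
      (((1 : Matrix R R ℂ) ⊗ₖ V) *ᵥ φ) (i.1, i.2, e))ᴴ := by
    ext i j
    rw [Matrix.mul_apply]
    rfl
  rw [h]
  exact Matrix.posSemidef_self_mul_conjTranspose _

lemma traceLeft_outputState {N : Matrix A A ℂ →ₗ[ℂ] Matrix B B ℂ} {V : Matrix (B × E) A ℂ}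
    (hV : IsIsometricExtension N V) (φ : R × A → ℂ) :
    traceLeft (outputState V φ) = N (inputState φ) := by
  rw [hV.2, isometry_mul_inputState]
  ext b b'
  simp only [traceLeft, traceRight, outputState, Matrix.of_apply, kronecker_mulVec_apply,
    Matrix.transpose_apply]
  rw [Finset.sum_comm]
  refine Finset.sum_congr rfl fun e _ => ?_
  rw [Matrix.mul_apply]
  exact Finset.sum_congr rfl fun r _ => mul_comm _ _

/-- The isometry does not act on R, so the R-marginal is that of the input vector, whose two
marginals have equal entropy. -/
lemma entropy_traceRight_outputState {N : Matrix A A ℂ →ₗ[ℂ] Matrix B B ℂ}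
    {V : Matrix (B × E) A ℂ} (hV : IsIsometricExtension N V) (φ : R × A → ℂ) :
    entropy (traceRight (outputState V φ)) = entropy (inputState φ) := by
  set Φ : Matrix R A ℂ := Matrix.of fun r a => φ (r, a) with hΦ
  have h1 : traceRight (outputState V φ) = (Φ * Vᵀ) * (Φ * Vᵀ)ᴴ := by
    ext r r'
    simp only [traceRight, outputState, Matrix.of_apply, kronecker_mulVec_apply]
    rw [Matrix.mul_apply, Fintype.sum_prod_type]
    rfl
  have h2 : Vᵀ * Vᵀᴴ = 1 := by
    rw [← Matrix.transpose_one, ← hV.1, Matrix.transpose_mul]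
    rfl
  have h3 : (Φ * Vᵀ) * (Φ * Vᵀ)ᴴ = Φ * Φᴴ := by
    rw [Matrix.conjTranspose_mul, Matrix.mul_assoc, ← Matrix.mul_assoc Vᵀ, h2, Matrix.one_mul]
  rw [h1, h3, inputState_eq, ← hΦ, entropy_mul_conjTranspose,
    entropy_transpose (Matrix.isHermitian_conjTranspose_mul_self Φ)]

/-- The vector on R ⊗ B ⊗ E is pure, so RB and E carry the same entropy. -/
lemma entropy_outputState (V : Matrix (B × E) A ℂ) (φ : R × A → ℂ) :
    entropy (outputState V φ) = entropy (complement V (inputState φ)) := by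
  set M : Matrix (R × B) E ℂ := Matrix.of fun (i : R × B) e =>
      (((1 : Matrix R R ℂ) ⊗ₖ V) *ᵥ φ) (i.1, i.2, e) with hM
  have h : outputState V φ = M * Mᴴ := by
    ext i j
    rw [Matrix.mul_apply]
    rfl
  have h2 : complement V (inputState φ) = (Mᴴ * M)ᵀ := by
    rw [complement_apply, isometry_mul_inputState]
    ext e e'
    simp only [traceLeft, Matrix.of_apply, Matrix.transpose_apply]
    rw [Matrix.mul_apply, Fintype.sum_prod_type_right]
    refine Finset.sum_congr rfl fun b _ => ?_
    rw [Matrix.mul_apply]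
    refine Finset.sum_congr rfl fun r _ => ?_
    simp only [hM, Matrix.conjTranspose_apply, Matrix.of_apply, kronecker_mulVec_apply]
  rw [h, h2, entropy_transpose (Matrix.isHermitian_conjTranspose_mul_self M),
    entropy_mul_conjTranspose]

/-- The weight is absorbed into the vector as √p, so that each block is the rank-one operator of one
unnormalized vector. -/
lemma quantumState_apply (V : Matrix (B × E) A ℂ) {p : X → ℝ} (hp : ∀ x, 0 ≤ p x)
    (φ : X → R × A → ℂ) (x x' : X) (i j : R × B × E) :
    quantumState V p φ (x, i) (x', j) =
      if x = x' then (((1 : Matrix R R ℂ) ⊗ₖ V) *ᵥ ((√(p x) : ℂ) • φ x)) i *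
        star ((((1 : Matrix R R ℂ) ⊗ₖ V) *ᵥ ((√(p x) : ℂ) • φ x)) j) else 0 := by
  simp only [quantumState, Matrix.sum_apply, Matrix.smul_apply, Matrix.kroneckerMap_apply,
    Matrix.single_apply, smul_eq_mul]
  rw [Finset.sum_eq_single x]
  · by_cases h : x = x'
    · subst h
      have h2 : ((√(p x) : ℝ) : ℂ) * ((√(p x) : ℝ) : ℂ) = (p x : ℂ) := by
        rw [← Complex.ofReal_mul, Real.mul_self_sqrt (hp x)]
      rw [Matrix.mul_vecMulVec, Matrix.vecMulVec_mul, ← Matrix.star_mulVec,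
        Matrix.vecMulVec_apply, Matrix.mulVec_smul]
      simp only [and_self, if_true, one_mul, Pi.smul_apply, Pi.star_apply, smul_eq_mul, star_mul,
        RCLike.star_def, Complex.conj_ofReal, ← h2]
      ring
    · simp [h]
  · intro b _ hb; simp [hb]
  · simp

lemma IsIsometricExtension.trace_eq {A B E : Type*} [Fintype A] [DecidableEq A] [Fintype B]
    [Fintype E] {N : Matrix A A ℂ →ₗ[ℂ] Matrix B B ℂ} {V : Matrix (B × E) A ℂ}
    (hV : IsIsometricExtension N V) (ρ : Matrix A A ℂ) : (N ρ).trace = ρ.trace := by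
  rw [hV.2, trace_traceRight, Matrix.trace_mul_cycle, hV.1, Matrix.one_mul]

lemma IsIsometricExtension.trace_complement {A B E : Type*} [Fintype A] [DecidableEq A]
    [Fintype B] [Fintype E] {N : Matrix A A ℂ →ₗ[ℂ] Matrix B B ℂ} {V : Matrix (B × E) A ℂ}
    (hV : IsIsometricExtension N V) (ρ : Matrix A A ℂ) : (complement V ρ).trace = ρ.trace := by
  have h : (complement V ρ).trace = (V * ρ * Vᴴ).trace := by
    simp [complement_apply, traceLeft, Matrix.trace, Fintype.sum_prod_type_right]
  rw [h, Matrix.trace_mul_cycle, hV.1, Matrix.one_mul]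

/-- By purity H(R) and H(RB) become entropies of the input and of the complementary output. Both
channels preserve the trace, so the η corrections inside the `nent` terms add up to μ ∑ η(Tr τ_x),
exactly what I(X;B) contributes. -/
lemma quantumObjective_eq {N : Matrix A A ℂ →ₗ[ℂ] Matrix B B ℂ} {V : Matrix (B × E) A ℂ}
    (hV : IsIsometricExtension N V) (lam mu : ℝ) {p : X → ℝ} (hp : ∀ x, 0 ≤ p x)
    (φ : X → R × A → ℂ) :
    quantumObjective lam mu (quantumState V p φ) =
      quantumForm N (complement V) lam mu fun x => inputState ((√(p x) : ℂ) • φ x) := by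
  set φ' : X → R × A → ℂ := fun x => (√(p x) : ℂ) • φ x
  set ω : X → Matrix (R × B) (R × B) ℂ := fun x => outputState V (φ' x)
  have hω : ∀ x, (ω x).IsHermitian := fun x => (outputState_posSemidef V (φ' x)).1
  have hL : ∀ x, traceLeft (ω x) = N (inputState (φ' x)) := fun x => traceLeft_outputState hV _
  have hτ : ∀ x, (inputState (φ' x)).PosSemidef := fun x => inputState_posSemidef _
  have hN : ∀ x, (N (inputState (φ' x))).IsHermitian := fun x => (hV.posSemidef (hτ x)).1
  have hsum : ∀ x x' r r' b b', ∑ e, quantumState V p φ (x, r, b, e) (x', r', b', e) =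
      if x = x' then ω x (r, b) (r', b') else 0 := by
    intro x x' r r' b b'
    simp only [quantumState_apply V hp]
    by_cases h : x = x'
    · subst h; simp only [if_true]; rfl
    · simp [h]
  have h1 : mutualInfo (Matrix.of fun i j : (R × X) × B =>
      ∑ e, quantumState V p φ (i.1.2, i.1.1, i.2, e) (j.1.2, j.1.1, j.2, e)) =
      entropy (N (∑ x, inputState (φ' x))) + ∑ x, entropy (inputState (φ' x)) -
        ∑ x, entropy (complement V (inputState (φ' x))) := by
    set σ : Matrix ((R × X) × B) ((R × X) × B) ℂ := Matrix.of fun i j =>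
      ∑ e, quantumState V p φ (i.1.2, i.1.1, i.2, e) (j.1.2, j.1.1, j.2, e) with hσ
    have hσ' : ∀ r x b r' x' b', σ ((r, x), b) ((r', x'), b') =
        if x = x' then ω x (r, b) (r', b') else 0 := fun r x b r' x' b' => hsum _ _ _ _ _ _
    have a1 : entropy (traceRight σ) = ∑ x, entropy (inputState (φ' x)) := by
      rw [entropy_of_blocks_right (fun x => traceRight (ω x))
        (fun x => (traceRight_posSemidef (outputState_posSemidef V (φ' x))).1)]
      · exact Finset.sum_congr rfl fun x _ => entropy_traceRight_outputState hV _
      · intro r x r' x'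
        simp only [traceRight, Matrix.of_apply, hσ']
        by_cases h : x = x' <;> simp [h]
    have a2 : traceLeft σ = N (∑ x, inputState (φ' x)) := by
      rw [map_sum]
      simp only [← hL]
      ext b b'
      simp only [traceLeft, Matrix.of_apply, Matrix.sum_apply, Fintype.sum_prod_type_right, hσ',
        if_true]
    have a3 : entropy σ = ∑ x, entropy (complement V (inputState (φ' x))) := by
      let e : (R × X) × B ≃ (R × B) × X :=
        { toFun := fun i => ((i.1.1, i.2), i.1.2)
          invFun := fun i => ((i.1.1, i.2), i.1.2)
          left_inv := fun _ => rfl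
          right_inv := fun _ => rfl }
      rw [entropy_of_blocks e ω hω]
      · exact Finset.sum_congr rfl fun x _ => entropy_outputState _ _
      · rintro ⟨⟨r, x⟩, b⟩ ⟨⟨r', x'⟩, b'⟩
        exact hσ' _ _ _ _ _ _
    rw [mutualInfo, a1, a2, a3]
    ring
  have h2 : coherentInfo (Matrix.of fun i j : R × B × X =>
      ∑ e, quantumState V p φ (i.2.2, i.1, i.2.1, e) (j.2.2, j.1, j.2.1, e)) =
      ∑ x, entropy (N (inputState (φ' x))) - ∑ x, entropy (complement V (inputState (φ' x))) := by
    set σ : Matrix (R × B × X) (R × B × X) ℂ := Matrix.of fun i j =>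
      ∑ e, quantumState V p φ (i.2.2, i.1, i.2.1, e) (j.2.2, j.1, j.2.1, e) with hσ
    have hσ' : ∀ r b x r' b' x', σ (r, b, x) (r', b', x') =
        if x = x' then ω x (r, b) (r', b') else 0 := fun r x b r' x' b' => hsum _ _ _ _ _ _
    have a1 : entropy (traceLeft σ) = ∑ x, entropy (N (inputState (φ' x))) := by
      refine entropy_of_blocks_right _ hN _ fun b x b' x' => ?_
      simp only [← hL]
      simp only [traceLeft, Matrix.of_apply, hσ']
      by_cases h : x = x' <;> simp [h]
    have a3 : entropy σ = ∑ x, entropy (complement V (inputState (φ' x))) := by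
      let e : R × B × X ≃ (R × B) × X := (Equiv.prodAssoc R B X).symm
      rw [entropy_of_blocks e ω hω]
      · exact Finset.sum_congr rfl fun x _ => entropy_outputState _ _
      · rintro ⟨r, b, x⟩ ⟨r', b', x'⟩
        exact hσ' _ _ _ _ _ _
    rw [coherentInfo, a1, a3]
  have h3 : mutualInfo (Matrix.of fun i j : X × B =>
      ∑ r, ∑ e, quantumState V p φ (i.1, r, i.2, e) (j.1, r, j.2, e)) =
      entropy (N (∑ x, inputState (φ' x))) - ∑ x, nent (N (inputState (φ' x))) := by
    rw [mutualInfo_of_blocks (fun x => N (inputState (φ' x))) hN, map_sum]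
    intro x b x' b'
    simp only [← hL]
    simp only [traceLeft, Matrix.of_apply, hsum]
    by_cases h : x = x' <;> simp [h]
  simp only [quantumObjective, h1, h2, h3, quantumForm, nent, hV.trace_eq, hV.trace_complement,
    Finset.sum_sub_distrib, Finset.sum_add_distrib, ← Finset.mul_sum]
  ring

end Quantum

end PrivateDynamic

namespace PrivateDynamic

/-! ### Maxima over two-level ensembles -/

section Ensembles

variable {E : Type*} [AddCommGroup E] [Module ℝ E]

/-- Carathéodory with a fixed number of points: missing points are filled in by a base point of
weight 0. The fixed number makes the parameter space compact when s is. -/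
lemma convexHull_eq_image_stdSimplex [FiniteDimensional ℝ E] {s : Set E} :
    convexHull ℝ s =
      (fun wz : (Fin (Module.finrank ℝ E + 1) → ℝ) × (Fin (Module.finrank ℝ E + 1) → E) =>
        ∑ i, wz.1 i • wz.2 i) ''
        (stdSimplex ℝ (Fin (Module.finrank ℝ E + 1)) ×ˢ Set.univ.pi fun _ => s) := by
  apply Set.Subset.antisymm
  · intro x hx
    obtain ⟨ι, _, z, w, hz, hi, hw, hw1, rfl⟩ := eq_pos_convex_span_of_mem_convexHull hx
    have hcard : Fintype.card ι ≤ Fintype.card (Fin (Module.finrank ℝ E + 1)) := by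
      rw [Fintype.card_fin]
      exact hi.card_le_finrank_succ.trans
        (Nat.add_le_add_right (Submodule.finrank_le _) 1)
    obtain ⟨f⟩ := Function.Embedding.nonempty_of_card_le hcard
    obtain ⟨z0, hz0⟩ : s.Nonempty := convexHull_nonempty_iff.1 ⟨_, hx⟩
    refine ⟨(Function.extend f w 0, Function.extend f z fun _ => z0), ⟨⟨?_, ?_⟩, ?_⟩, ?_⟩
    · intro i
      by_cases h : ∃ j, f j = i
      · obtain ⟨j, rfl⟩ := h
        simpa [f.injective.extend_apply] using (hw j).le
      · simp [Function.extend_apply' _ _ _ h]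
    · rw [← hw1]
      refine (Fintype.sum_of_injective f f.injective _ _ ?_ ?_).symm
      · intro i hi
        simp [Function.extend_apply' _ _ _ (by simpa using hi)]
      · intro i
        simp [f.injective.extend_apply]
    · intro i _
      by_cases h : ∃ j, f j = i
      · obtain ⟨j, rfl⟩ := h
        simpa [f.injective.extend_apply] using hz (Set.mem_range_self j)
      · simpa [Function.extend_apply' _ _ _ h] using hz0
    · refine (Fintype.sum_of_injective f f.injective _ _ ?_ ?_).symm
      · intro i hi
        simp [Function.extend_apply' _ _ _ (by simpa using hi)]
      · intro i
        simp [f.injective.extend_apply]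
  · rintro _ ⟨⟨w, z⟩, ⟨⟨hw, hw1⟩, hz⟩, rfl⟩
    exact mem_convexHull_of_exists_fintype w z hw hw1 (fun i => hz i trivial) rfl

/-- In finite dimensions the convex hull of a compact set is compact. -/
lemma isCompact_convexHull_of_isCompact [TopologicalSpace E] [IsTopologicalAddGroup E]
    [ContinuousSMul ℝ E] [FiniteDimensional ℝ E] {s : Set E} (hs : IsCompact s) :
    IsCompact (convexHull ℝ s) := by
  rw [convexHull_eq_image_stdSimplex]
  refine ((isCompact_stdSimplex ℝ _).prod (isCompact_univ_pi fun _ => hs)).image ?_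
  fun_prop

/-- Pairs of the barycenter and the value of a two-level ensemble. -/
def ensembleHull (K : Set E) (G H : E → ℝ) : Set (E × ℝ) :=
  convexHull ℝ ((fun a : E × ℝ => (a.1, G a.1 + a.2)) ''
    convexHull ℝ ((fun z => (z, H z)) '' K))

lemma fst_mem_of_mem_ensembleHull {K : Set E} (hK : Convex ℝ K) {G H : E → ℝ} {a : E × ℝ}
    (ha : a ∈ ensembleHull K G H) : a.1 ∈ K := by
  have hc : Convex ℝ (Prod.fst ⁻¹' K : Set (E × ℝ)) := hK.linear_preimage (LinearMap.fst ℝ E ℝ)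
  have h1 : convexHull ℝ ((fun z => (z, H z)) '' K) ⊆ Prod.fst ⁻¹' K :=
    convexHull_min (by rintro _ ⟨z, hz, rfl⟩; exact hz) hc
  have h2 : ensembleHull K G H ⊆ Prod.fst ⁻¹' K :=
    convexHull_min (by rintro _ ⟨b, hb, rfl⟩; exact (h1 hb : b.1 ∈ K)) hc
  exact h2 ha

lemma isCompact_ensembleHull [TopologicalSpace E] [IsTopologicalAddGroup E] [ContinuousSMul ℝ E]
    [FiniteDimensional ℝ E] {K : Set E} (hK : Convex ℝ K) (hK' : IsCompact K) {G H : E → ℝ}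
    (hG : ContinuousOn G K) (hH : ContinuousOn H K) : IsCompact (ensembleHull K G H) := by
  have hc : Convex ℝ (Prod.fst ⁻¹' K : Set (E × ℝ)) := hK.linear_preimage (LinearMap.fst ℝ E ℝ)
  have h1 : convexHull ℝ ((fun z => (z, H z)) '' K) ⊆ Prod.fst ⁻¹' K :=
    convexHull_min (by rintro _ ⟨z, hz, rfl⟩; exact hz) hc
  refine isCompact_convexHull_of_isCompact (IsCompact.image_of_continuousOn
    (isCompact_convexHull_of_isCompact (hK'.image_of_continuousOn
      (continuousOn_id.prodMk hH))) ?_)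
  refine continuousOn_fst.prodMk (ContinuousOn.add ?_ continuousOn_snd)
  exact hG.comp continuousOn_fst h1

/-- A two-level ensemble of points of `K`: a joint distribution and a family of points. -/
structure IsEnsemble {X Y : Type*} [Fintype X] [Fintype Y] (K : Set E) (p : X → Y → ℝ)
    (z : X → Y → E) : Prop where
  nonneg : ∀ x y, 0 ≤ p x y
  sum_eq_one : ∑ x, ∑ y, p x y = 1
  mem : ∀ x y, z x y ∈ K

/-- The pair of the barycenter and the value of a two-level ensemble. -/
noncomputable def ensemblePoint {X Y : Type*} [Fintype X] [Fintype Y] (G H : E → ℝ)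
    (p : X → Y → ℝ) (z : X → Y → E) : E × ℝ :=
  (∑ x, ∑ y, p x y • z x y,
    ∑ x, (∑ y, p x y) * G ((∑ y, p x y)⁻¹ • ∑ y, p x y • z x y) + ∑ x, ∑ y, p x y * H (z x y))

lemma IsEnsemble.ensemblePoint_mem {X Y : Type*} [Fintype X] [Fintype Y] {K : Set E}
    {p : X → Y → ℝ} {z : X → Y → E} (h : IsEnsemble K p z) (G H : E → ℝ) :
    ensemblePoint G H p z ∈ ensembleHull K G H := by
  set b : X → E × ℝ := fun x => (∑ y, p x y)⁻¹ • ∑ y, p x y • (z x y, H (z x y)) with hb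
  have hp : ∀ x, 0 ≤ ∑ y, p x y := fun x => Finset.sum_nonneg fun y _ => h.nonneg x y
  -- Letters of weight zero are dropped: the inverse weight is then 0, and the resulting point `b x`
  -- need not lie in the inner hull.
  have h1 : ∀ x ∈ Finset.univ.filter (fun x => ∑ y, p x y ≠ 0),
      ((b x).1, G (b x).1 + (b x).2) ∈ ensembleHull K G H := by
    intro x hx
    have hx0 : ∑ y, p x y ≠ 0 := (Finset.mem_filter.1 hx).2
    refine subset_convexHull _ _ ⟨b x, ?_, rfl⟩
    refine mem_convexHull_of_exists_fintype (fun y => (∑ y, p x y)⁻¹ * p x y)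
      (fun y => (z x y, H (z x y))) (fun y => mul_nonneg (inv_nonneg.2 (hp x)) (h.nonneg x y))
      ?_ (fun y => ⟨z x y, h.mem x y, rfl⟩) ?_
    · rw [← Finset.mul_sum, inv_mul_cancel₀ hx0]
    · simp only [hb, Finset.smul_sum, smul_smul]
  have h2 : ∑ x with ∑ y, p x y ≠ 0, ∑ y, p x y = 1 := by
    rw [Finset.sum_filter_ne_zero, h.sum_eq_one]
  have h3 := (convex_convexHull ℝ _).sum_mem (fun x _ => hp x) h2 h1
  have h4 : ensemblePoint G H p z =
      ∑ x with ∑ y, p x y ≠ 0, (∑ y, p x y) • ((b x).1, G (b x).1 + (b x).2) := by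
    have h5 : ∀ x, (∑ y, p x y) • ((b x).1, G (b x).1 + (b x).2) =
        (∑ y, p x y • z x y, (∑ y, p x y) * G ((∑ y, p x y)⁻¹ • ∑ y, p x y • z x y) +
          ∑ y, p x y * H (z x y)) := by
      intro x
      by_cases hx : ∑ y, p x y = 0
      · have hx' : ∀ y, p x y = 0 := fun y =>
          (Finset.sum_eq_zero_iff_of_nonneg fun y _ => h.nonneg x y).1 hx y (Finset.mem_univ y)
        simp [hx']
        rfl
      · simp only [hb, Prod.smul_mk, Prod.smul_fst, Prod.smul_snd, Prod.fst_sum, Prod.snd_sum,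
          smul_smul, mul_inv_cancel₀ hx, one_smul, smul_eq_mul, mul_add, ← mul_assoc, one_mul]
    rw [Finset.sum_filter_of_ne]
    · simp only [h5, ensemblePoint]
      ext
      · simp [Prod.fst_sum]
      · simp [Prod.snd_sum, Finset.sum_add_distrib]
    · intro x _ hx hx0
      exact hx (by rw [hx0, zero_smul])
  rw [h4]
  exact h3

lemma sum_sigma_ite {ι F : Type*} [Fintype ι] [DecidableEq ι] {κ : ι → Type*}
    [∀ i, Fintype (κ i)] [AddCommMonoid F] (i : ι) (f : (Σ i, κ i) → F) :
    ∑ k, (if k.1 = i then f k else 0) = ∑ j, f ⟨i, j⟩ := by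
  rw [Fintype.sum_sigma, Finset.sum_eq_single i]
  · simp
  · intro j _ hj
    simp [hj]
  · simp

/-- Unfolding both hulls gives a distribution on x and, for each x, one on its own alphabet. -/
lemma exists_ensemblePoint_eq {K : Set E} {G H : E → ℝ} {a : E × ℝ}
    (ha : a ∈ ensembleHull K G H) :
    ∃ (X Y : Type) (_ : Fintype X) (_ : Fintype Y) (p : X → Y → ℝ) (z : X → Y → E),
      IsEnsemble K p z ∧ ensemblePoint G H p z = a := by
  classical
  obtain ⟨X, _, w, b, hw, hw1, hb, rfl⟩ := mem_convexHull_iff_exists_fintype.1 ha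
  choose c hc hcb using hb
  choose Y' _ q u hq hq1 hu huc using fun x => mem_convexHull_iff_exists_fintype.1 (hc x)
  choose v hv hvu using hu
  -- The second alphabet must not depend on x, so the disjoint union is used, with weight 0 off the
  -- fibre of x.
  set p : X → (Σ x, Y' x) → ℝ := fun x i => if i.1 = x then w x * q i.1 i.2 else 0 with hp
  set z : X → (Σ x, Y' x) → E := fun _ i => v i.1 i.2 with hz
  have hsum : ∀ x, ∑ i, p x i = w x := fun x => by
    rw [hp, sum_sigma_ite, ← Finset.mul_sum, hq1, mul_one]
  have hpz : ∀ x, ∑ i, p x i • z x i = w x • (c x).1 := fun x => by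
    simp only [hp, hz, ite_smul, zero_smul]
    rw [sum_sigma_ite x (fun i => (w x * q i.1 i.2) • v i.1 i.2), ← huc, Prod.fst_sum,
      Finset.smul_sum]
    refine Finset.sum_congr rfl fun y _ => ?_
    rw [← hvu]
    simp [mul_smul]
  have hpH : ∀ x, ∑ i, p x i * H (z x i) = w x * (c x).2 := fun x => by
    simp only [hp, hz, ite_mul, zero_mul]
    rw [sum_sigma_ite x (fun i => (w x * q i.1 i.2) * H (v i.1 i.2)), ← huc, Prod.snd_sum,
      Finset.mul_sum]
    refine Finset.sum_congr rfl fun y _ => ?_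
    rw [← hvu]
    simp [mul_assoc]
  refine ⟨X, Σ x, Y' x, inferInstance, inferInstance, p, z, ⟨fun x i => ?_, ?_, fun x i => ?_⟩, ?_⟩
  · simp only [hp]
    split_ifs with hi
    · exact mul_nonneg (hw x) (hq _ _)
    · exact le_rfl
  · simp only [hsum, hw1]
  · exact hv i.1 i.2
  · simp only [ensemblePoint, hsum, hpz, hpH, ← hcb]
    ext
    · simp [Prod.fst_sum]
    · simp only [Prod.snd_sum, Prod.smul_snd, smul_eq_mul, mul_add, Finset.sum_add_distrib]
      congr 1
      refine Finset.sum_congr rfl fun x _ => ?_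
      by_cases hx : w x = 0
      · simp [hx]
      · rw [smul_smul, inv_mul_cancel₀ hx, one_smul]

/-- A continuous function of the barycenter plus the value attains its maximum over all two-level
ensembles. -/
lemma exists_isMax_ensemble [TopologicalSpace E] [IsTopologicalAddGroup E] [ContinuousSMul ℝ E]
    [FiniteDimensional ℝ E] {K : Set E} (hK : Convex ℝ K) (hK' : IsCompact K)
    (hne : K.Nonempty) {F G H : E → ℝ} (hF : ContinuousOn F K)
    (hG : ContinuousOn G K) (hH : ContinuousOn H K) :
    ∃ (X Y : Type) (_ : Fintype X) (_ : Fintype Y) (p : X → Y → ℝ) (z : X → Y → E),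
      IsEnsemble K p z ∧ ∀ {X' Y' : Type} [Fintype X'] [Fintype Y'] (p' : X' → Y' → ℝ)
        (z' : X' → Y' → E), IsEnsemble K p' z' →
          F (ensemblePoint G H p' z').1 + (ensemblePoint G H p' z').2 ≤
            F (ensemblePoint G H p z).1 + (ensemblePoint G H p z).2 := by
  obtain ⟨z0, hz0⟩ := hne
  have hne' : (ensembleHull K G H).Nonempty :=
    ⟨_, subset_convexHull _ _ ⟨_, subset_convexHull _ _ ⟨z0, hz0, rfl⟩, rfl⟩⟩
  have hc : ContinuousOn (fun a : E × ℝ => F a.1 + a.2) (ensembleHull K G H) :=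
    (hF.comp continuousOn_fst fun a ha => fst_mem_of_mem_ensembleHull hK ha).add continuousOn_snd
  obtain ⟨a, ha, hmax⟩ := (isCompact_ensembleHull hK hK' hG hH).exists_isMaxOn hne' hc
  obtain ⟨X, Y, _, _, p, z, hpz, rfl⟩ := exists_ensemblePoint_eq ha
  exact ⟨X, Y, inferInstance, inferInstance, p, z, hpz,
    fun p' z' h => hmax (h.ensemblePoint_mem G H)⟩

end Ensembles

end PrivateDynamic

namespace PrivateDynamic

/-! ### The set of density operators -/

section Density

variable {A B E : Type*} [Fintype A] [DecidableEq A] [Fintype B] [DecidableEq B] [Fintype E]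
  [DecidableEq E]

lemma trace_mul_conjTranspose_self {R : Type*} [Fintype R] (C : Matrix A R ℂ) :
    (C * Cᴴ).trace = ((∑ i, ∑ j, ‖C i j‖ ^ 2 : ℝ) : ℂ) := by
  simp only [Matrix.trace, Matrix.diag, Matrix.mul_apply, Matrix.conjTranspose_apply,
    RCLike.star_def, Complex.mul_conj', Complex.ofReal_sum, Complex.ofReal_pow]

lemma convex_isDensity : Convex ℝ {ρ : Matrix A A ℂ | IsDensity ρ} := by
  intro ρ hρ τ hτ a b ha hb hab
  have h : ∀ (c : ℝ) (ω : Matrix A A ℂ), c • ω = (c : ℂ) • ω := fun c ω =>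
    (Complex.coe_smul c ω).symm
  rw [Set.mem_ofPred_eq, h, h]
  refine ⟨(hρ.1.smul (by exact_mod_cast ha)).add (hτ.1.smul (by exact_mod_cast hb)), ?_⟩
  rw [Matrix.trace_add, Matrix.trace_smul, Matrix.trace_smul, hρ.2, hτ.2]
  simp only [smul_eq_mul, mul_one]
  exact_mod_cast hab

/-- The density operators are the image of the Frobenius unit sphere under C ↦ C Cᴴ. -/
lemma isCompact_isDensity : IsCompact {ρ : Matrix A A ℂ | IsDensity ρ} := by
  have h1 : IsCompact {C : Matrix A A ℂ | ∑ i, ∑ j, ‖C i j‖ ^ 2 = 1} := by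
    have hb : IsCompact (Set.univ.pi fun _ : A => Set.univ.pi fun _ : A =>
        Metric.closedBall (0 : ℂ) 1) :=
      isCompact_univ_pi fun _ => isCompact_univ_pi fun _ => isCompact_closedBall _ _
    refine IsCompact.of_isClosed_subset (X := A → A → ℂ) hb ?_ ?_
    · refine isClosed_eq ?_ continuous_const
      fun_prop
    · intro C hC i _ j _
      rw [mem_closedBall_zero_iff, ← sq_le_one_iff₀ (norm_nonneg _)]
      rw [← show ∑ i, ∑ j, ‖C i j‖ ^ 2 = 1 from hC]
      refine le_trans ?_ (Finset.single_le_sum (f := fun i => ∑ j, ‖C i j‖ ^ 2)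
        (fun i _ => Finset.sum_nonneg fun j _ => sq_nonneg _) (Finset.mem_univ i))
      exact Finset.single_le_sum (f := fun j => ‖C i j‖ ^ 2) (fun j _ => sq_nonneg _)
        (Finset.mem_univ j)
  have h2 : {ρ : Matrix A A ℂ | IsDensity ρ} =
      (fun C : Matrix A A ℂ => C * Cᴴ) '' {C : Matrix A A ℂ | ∑ i, ∑ j, ‖C i j‖ ^ 2 = 1} := by
    ext ρ
    constructor
    · rintro ⟨h, htr⟩
      obtain ⟨C, rfl⟩ := exists_mul_conjTranspose h
      refine ⟨C, ?_, rfl⟩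
      rw [trace_mul_conjTranspose_self] at htr
      exact_mod_cast htr
    · rintro ⟨C, hC, rfl⟩
      refine ⟨Matrix.posSemidef_self_mul_conjTranspose C, ?_⟩
      rw [trace_mul_conjTranspose_self, show ∑ i, ∑ j, ‖C i j‖ ^ 2 = 1 from hC]
      simp
  rw [h2]
  exact h1.image (by fun_prop)

lemma exists_isDensity [Nonempty A] : ∃ ρ : Matrix A A ℂ, IsDensity ρ :=
  let ⟨ω, hω, _⟩ := eq_trace_smul_isDensity (Matrix.PosSemidef.zero (n := A) (R := ℂ))
  ⟨ω, hω⟩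

lemma continuousOn_nent : ContinuousOn (nent : Matrix A A ℂ → ℝ) {ρ | ρ.IsHermitian} :=
  continuousOn_entropy.sub (continuous_eta.comp (Complex.continuous_re.comp
    (Continuous.matrix_trace continuous_id))).continuousOn

lemma continuousOn_entropy_map (N : Matrix A A ℂ →ₗ[ℂ] Matrix B B ℂ)
    (hN : ∀ ρ, ρ.PosSemidef → (N ρ).PosSemidef) :
    ContinuousOn (fun ρ => entropy (N ρ)) {ρ | IsDensity ρ} :=
  continuousOn_entropy.comp N.continuous_of_finiteDimensional.continuousOn
    fun ρ hρ => (hN ρ hρ.1).1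

lemma continuousOn_nent_map (N : Matrix A A ℂ →ₗ[ℂ] Matrix B B ℂ)
    (hN : ∀ ρ, ρ.PosSemidef → (N ρ).PosSemidef) :
    ContinuousOn (fun ρ => nent (N ρ)) {ρ | IsDensity ρ} :=
  continuousOn_nent.comp N.continuous_of_finiteDimensional.continuousOn
    fun ρ hρ => (hN ρ hρ.1).1

end Density

/-! ### Private versus quantum objective -/

section Comparison

variable {A B E X Y : Type*} [Fintype A] [DecidableEq A] [Fintype B] [DecidableEq B] [Fintype E]
  [DecidableEq E] [Fintype X] [Fintype Y]

/-- For a degradable channel, the private objective of an ensemble is at most the quantum objective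
of purifications of the coarse-grained ensemble. -/
lemma privateForm_le_quantumForm [Nonempty A] {N : Matrix A A ℂ →ₗ[ℂ] Matrix B B ℂ}
    (hdeg : IsDegradable N) {V : Matrix (B × E) A ℂ} (hV : IsIsometricExtension N V)
    {lam mu : ℝ} (hlam : 0 ≤ lam) (hmu : 0 ≤ mu) (τ : X → Y → Matrix A A ℂ)
    (hτ : ∀ x y, (τ x y).PosSemidef) :
    privateForm N (complement V) lam mu τ ≤
      quantumForm N (complement V) lam mu fun x => ∑ y, τ x y := by
  have h1 : ∀ x y, nent (complement V (τ x y)) ≤ nent (N (τ x y)) := fun x y => by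
    rw [nent, nent, hV.trace_eq, hV.trace_complement]
    exact sub_le_sub_right (entropy_complement_le hdeg hV (hτ x y)) _
  have h2 : ∀ x, nent (complement V (∑ y, τ x y)) - ∑ y, nent (complement V (τ x y)) ≤
      nent (∑ y, τ x y) - ∑ y, nent (τ x y) := fun x => by
    have h := holevo_complement hV (τ x) (hτ x)
    simp only [nent, hV.trace_complement, Finset.sum_sub_distrib]
    simp only [complement_apply]
    linarith
  have h3 : ∀ x y, 0 ≤ nent (τ x y) := fun x y => sub_nonneg.2 (eta_trace_le_entropy (hτ x y))
  have h4 : ∀ x, lam * nent (N (∑ y, τ x y)) - (lam + mu) * nent (complement V (∑ y, τ x y)) +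
      ∑ y, ((lam + mu) * nent (complement V (τ x y)) - (1 + lam + mu) * nent (N (τ x y))) ≤
      nent (∑ y, τ x y) + lam * nent (N (∑ y, τ x y)) -
        (1 + lam + mu) * nent (complement V (∑ y, τ x y)) := by
    intro x
    -- Replacing each `nent` of the N-output by the smaller one of the complement leaves the
    -- coefficient (λ+μ) - (1+λ+μ) = -1.
    have h5 : ∑ y, ((lam + mu) * nent (complement V (τ x y)) -
        (1 + lam + mu) * nent (N (τ x y))) ≤ ∑ y, -nent (complement V (τ x y)) := by
      refine Finset.sum_le_sum fun y _ => ?_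
      have := mul_le_mul_of_nonneg_left (h1 x y) (by positivity : 0 ≤ 1 + lam + mu)
      linarith
    have h6 : 0 ≤ ∑ y, nent (τ x y) := Finset.sum_nonneg fun y _ => h3 x y
    rw [Finset.sum_neg_distrib] at h5
    linarith [h2 x]
  rw [privateForm, quantumForm, add_assoc, ← Finset.sum_add_distrib]
  exact add_le_add le_rfl (Finset.sum_le_sum fun x _ => h4 x)

end Comparison

/-! ### Attainment of both maxima -/

section Maxima

variable {A B E : Type*} [Fintype A] [DecidableEq A] [Fintype B] [DecidableEq B] [Fintype E]
  [DecidableEq E]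

lemma nent_complement_eq {E' : Type*} [Fintype E'] [DecidableEq E']
    {N : Matrix A A ℂ →ₗ[ℂ] Matrix B B ℂ} {V : Matrix (B × E) A ℂ} {V' : Matrix (B × E') A ℂ}
    (hV : IsIsometricExtension N V) (hV' : IsIsometricExtension N V') {ρ : Matrix A A ℂ}
    (hρ : ρ.PosSemidef) : nent (complement V ρ) = nent (complement V' ρ) := by
  rw [nent, nent, hV.trace_complement, hV'.trace_complement, complement_apply, complement_apply,
    entropy_complement_eq hV hV' hρ]

lemma nent_zero {S : Type*} [Fintype S] [DecidableEq S] : nent (0 : Matrix S S ℂ) = 0 := by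
  simp [nent]

/-- Homogeneity lets conditional states be replaced by unnormalized ones. At c = 0 the convention
0⁻¹ = 0 makes the left side 0, and the hypothesis makes the right side 0. -/
lemma mul_nent_map_inv_smul (M : Matrix A A ℂ →ₗ[ℂ] Matrix E E ℂ)
    (hM : ∀ ρ, ρ.PosSemidef → (M ρ).PosSemidef) {τ : Matrix A A ℂ} (hτ : τ.PosSemidef) (c : ℝ)
    (hc : c = 0 → τ = 0) : c * nent (M (c⁻¹ • τ)) = nent (M τ) := by
  rw [← Complex.coe_smul, map_smul, nent_smul (hM _ hτ).1]
  by_cases h : c = 0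
  · simp [h, hc h, nent_zero]
  · rw [mul_inv_cancel_left₀ h]

lemma ensemblePoint_eq_privateForm {X Y : Type*} [Fintype X] [Fintype Y]
    {N : Matrix A A ℂ →ₗ[ℂ] Matrix B B ℂ} {V : Matrix (B × E) A ℂ}
    (hV : IsIsometricExtension N V) (lam mu : ℝ) {p : X → Y → ℝ} {ρ : X → Y → Matrix A A ℂ}
    (h : IsEnsemble {ρ | IsDensity ρ} p ρ) :
    (fun a : Matrix A A ℂ × ℝ => (1 + mu) * entropy (N a.1) + a.2) (ensemblePoint
      (fun τ => lam * nent (N τ) - (lam + mu) * nent (complement V τ))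
      (fun τ => (lam + mu) * nent (complement V τ) - (1 + lam + mu) * nent (N τ)) p ρ) =
    privateForm N (complement V) lam mu fun x y => (p x y : ℂ) • ρ x y := by
  have hτ : ∀ x y, ((p x y : ℂ) • ρ x y).PosSemidef := fun x y =>
    (h.mem x y).1.smul (by exact_mod_cast h.nonneg x y)
  have hτs : ∀ x, (∑ y, (p x y : ℂ) • ρ x y).PosSemidef := fun x =>
    Matrix.posSemidef_sum _ fun y _ => hτ x y
  have h0 : ∀ x, ∑ y, p x y = 0 → ∑ y, (p x y : ℂ) • ρ x y = 0 := fun x hx => by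
    refine Finset.sum_eq_zero fun y _ => ?_
    rw [(Finset.sum_eq_zero_iff_of_nonneg fun y _ => h.nonneg x y).1 hx y (Finset.mem_univ y)]
    simp
  have hN : ∀ x, (∑ y, p x y) * nent (N ((∑ y, p x y)⁻¹ • ∑ y, (p x y : ℂ) • ρ x y)) =
      nent (N (∑ y, (p x y : ℂ) • ρ x y)) := fun x =>
    mul_nent_map_inv_smul N (fun ρ hρ => hV.posSemidef hρ) (hτs x) _ (h0 x)
  have hM : ∀ x, (∑ y, p x y) *
      nent (complement V ((∑ y, p x y)⁻¹ • ∑ y, (p x y : ℂ) • ρ x y)) =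
      nent (complement V (∑ y, (p x y : ℂ) • ρ x y)) := fun x =>
    mul_nent_map_inv_smul _ (fun ρ hρ => complement_posSemidef V hρ) (hτs x) _ (h0 x)
  have hN' : ∀ x y, nent (N ((p x y : ℂ) • ρ x y)) = p x y * nent (N (ρ x y)) := fun x y => by
    rw [map_smul, nent_smul (hV.posSemidef (h.mem x y).1).1]
  have hM' : ∀ x y, nent (complement V ((p x y : ℂ) • ρ x y)) =
      p x y * nent (complement V (ρ x y)) := fun x y => by
    rw [map_smul, nent_smul (complement_posSemidef V (h.mem x y).1).1]
  have hs : ∀ x y, p x y • ρ x y = (p x y : ℂ) • ρ x y := fun x y => (Complex.coe_smul _ _).symm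
  simp only [ensemblePoint, privateForm, hs, ← hN, ← hM, hN', hM']
  rw [← add_assoc]
  congr 1
  · congr 1
    exact Finset.sum_congr rfl fun x _ => by ring
  · exact Finset.sum_congr rfl fun x _ => Finset.sum_congr rfl fun y _ => by ring

lemma exists_isGreatest_privateValues [Nonempty A] {N : Matrix A A ℂ →ₗ[ℂ] Matrix B B ℂ}
    (hN : IsChannel N) (lam mu : ℝ) : ∃ v, IsGreatest (privateValues lam mu N) v := by
  classical
  obtain ⟨k, V, hV⟩ := hN.exists_isIsometricExtension
  have cN := continuousOn_nent_map N (fun ρ hρ => hV.posSemidef hρ)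
  have cM := continuousOn_nent_map (complement V) (fun ρ hρ => complement_posSemidef V hρ)
  have cE := continuousOn_entropy_map N (fun ρ hρ => hV.posSemidef hρ)
  obtain ⟨X, Y, _, _, p, ρ, h, hmax⟩ := exists_isMax_ensemble (convex_isDensity (A := A))
    isCompact_isDensity exists_isDensity (F := fun ρ => (1 + mu) * entropy (N ρ))
    (G := fun τ => lam * nent (N τ) - (lam + mu) * nent (complement V τ))
    (H := fun τ => (lam + mu) * nent (complement V τ) - (1 + lam + mu) * nent (N τ))
    (cE.const_mul _) ((cN.const_mul _).sub (cM.const_mul _))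
    ((cM.const_mul _).sub (cN.const_mul _))
  have hpos : ∀ {X Y : Type} [Fintype X] [Fintype Y] {p : X → Y → ℝ}
      {ρ : X → Y → Matrix A A ℂ}, IsEnsemble {ρ | IsDensity ρ} p ρ →
      ∀ x y, ((p x y : ℂ) • ρ x y).PosSemidef := fun h x y =>
    (h.mem x y).1.smul (by exact_mod_cast h.nonneg x y)
  refine ⟨privateForm N (complement V) lam mu fun x y => (p x y : ℂ) • ρ x y, ?_, ?_⟩
  · exact ⟨X, Y, Fin k, inferInstance, inferInstance, inferInstance, inferInstance, inferInstance,
      inferInstance, V, p, ρ, hV, h.nonneg, h.sum_eq_one, h.mem,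
      (privateObjective_eq hV lam mu (hpos h)).symm⟩
  · rintro _ ⟨X', Y', E', _, _, _, _, _, _, V', p', ρ', hV', hp', hp1', hρ', rfl⟩
    have h' : IsEnsemble {ρ | IsDensity ρ} p' ρ' := ⟨hp', hp1', hρ'⟩
    -- Only entropies of complementary outputs enter, so every environment can be traded for the
    -- fixed one.
    have e1 : privateForm N (complement V') lam mu (fun x y => (p' x y : ℂ) • ρ' x y) =
        privateForm N (complement V) lam mu (fun x y => (p' x y : ℂ) • ρ' x y) := by
      have a1 := fun x => nent_complement_eq hV' hV
        (Matrix.posSemidef_sum Finset.univ fun y _ => hpos h' x y)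
      have a2 := fun x y => nent_complement_eq hV' hV (hpos h' x y)
      simp only [privateForm, a1, a2]
    rw [privateObjective_eq hV' lam mu (hpos h'), e1, ← ensemblePoint_eq_privateForm hV lam mu h',
      ← ensemblePoint_eq_privateForm hV lam mu h]
    exact hmax p' ρ' h'

lemma inputState_smul {R : Type*} [Fintype R] {c : ℝ} (hc : 0 ≤ c) (φ : R × A → ℂ) :
    inputState ((√c : ℂ) • φ) = (c : ℂ) • inputState φ := by
  rw [inputState, inputState, ← traceLeft_smul]
  congr 1
  ext i j
  have h2 : ((√c : ℝ) : ℂ) * ((√c : ℝ) : ℂ) = (c : ℂ) := by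
    rw [← Complex.ofReal_mul, Real.mul_self_sqrt hc]
  simp only [Matrix.vecMulVec_apply, Matrix.smul_apply, Pi.smul_apply, Pi.star_apply, smul_eq_mul,
    star_mul, RCLike.star_def, Complex.conj_ofReal, ← h2]
  ring

lemma trace_inputState {R : Type*} [Fintype R] (φ : R × A → ℂ) :
    (inputState φ).trace = ((∑ i, ‖φ i‖ ^ 2 : ℝ) : ℂ) := by
  rw [Fintype.sum_prod_type_right]
  simp only [inputState, traceLeft, Matrix.trace, Matrix.diag, Matrix.of_apply,
    Matrix.vecMulVec_apply, Pi.star_apply, RCLike.star_def, Complex.mul_conj', Complex.ofReal_sum,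
    Complex.ofReal_pow]

/-- Every density operator has a purification. -/
lemma exists_inputState_eq {ρ : Matrix A A ℂ} (hρ : IsDensity ρ) :
    ∃ φ : Fin (Fintype.card A) × A → ℂ, ∑ i, ‖φ i‖ ^ 2 = 1 ∧ inputState φ = ρ := by
  obtain ⟨C, hC⟩ := exists_mul_conjTranspose hρ.1
  -- The reference is a copy of A indexed by `Fin`, hence in `Type` as `quantumValues` requires,
  -- whatever the universe of A.
  let e := Fintype.equivFin A
  have h : inputState (fun i : Fin (Fintype.card A) × A => C i.2 (e.symm i.1)) = ρ := by
    ext a a'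
    rw [hC, Matrix.mul_apply, ← e.symm.sum_comp]
    rfl
  refine ⟨_, ?_, h⟩
  have h2 := trace_inputState (fun i : Fin (Fintype.card A) × A => C i.2 (e.symm i.1))
  rw [h, hρ.2] at h2
  exact_mod_cast h2.symm

/-- With G = 0 the coarse level contributes nothing, and the pair (x, y) acts as a single label. -/
lemma ensemblePoint_eq_quantumForm {X Y : Type*} [Fintype X] [Fintype Y]
    {N : Matrix A A ℂ →ₗ[ℂ] Matrix B B ℂ} {V : Matrix (B × E) A ℂ}
    (hV : IsIsometricExtension N V) (lam mu : ℝ) {p : X → Y → ℝ} {ρ : X → Y → Matrix A A ℂ}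
    (h : IsEnsemble {ρ | IsDensity ρ} p ρ) :
    (fun a : Matrix A A ℂ × ℝ => (1 + mu) * entropy (N a.1) + a.2) (ensemblePoint (fun _ => 0)
      (fun τ => nent τ + lam * nent (N τ) - (1 + lam + mu) * nent (complement V τ)) p ρ) =
    quantumForm N (complement V) lam mu fun k : X × Y => (p k.1 k.2 : ℂ) • ρ k.1 k.2 := by
  have hI : ∀ x y, nent ((p x y : ℂ) • ρ x y) = p x y * nent (ρ x y) := fun x y =>
    nent_smul (h.mem x y).1.1 _
  have hN' : ∀ x y, nent (N ((p x y : ℂ) • ρ x y)) = p x y * nent (N (ρ x y)) := fun x y => by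
    rw [map_smul, nent_smul (hV.posSemidef (h.mem x y).1).1]
  have hM' : ∀ x y, nent (complement V ((p x y : ℂ) • ρ x y)) =
      p x y * nent (complement V (ρ x y)) := fun x y => by
    rw [map_smul, nent_smul (complement_posSemidef V (h.mem x y).1).1]
  have hs : ∀ x y, p x y • ρ x y = (p x y : ℂ) • ρ x y := fun x y => (Complex.coe_smul _ _).symm
  simp only [ensemblePoint, quantumForm, hs, hI, hN', hM', Fintype.sum_prod_type, mul_zero,
    Finset.sum_const_zero, zero_add]
  congr 1
  exact Finset.sum_congr rfl fun x _ => Finset.sum_congr rfl fun y _ => by ring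

/-- The second clause bounds `quantumForm` on every ensemble of total trace 1, without reference to
purifications; this is the form in which the private objective is compared with the maximum. -/
lemma exists_isGreatest_quantumValues [Nonempty A] {N : Matrix A A ℂ →ₗ[ℂ] Matrix B B ℂ}
    (hN : IsChannel N) (lam mu : ℝ) : ∃ v, IsGreatest (quantumValues lam mu N) v ∧
      ∀ {X E : Type} [Fintype X] [Fintype E] [DecidableEq E] {V : Matrix (B × E) A ℂ}
        (τ : X → Matrix A A ℂ), IsIsometricExtension N V → (∀ x, (τ x).PosSemidef) →
        ∑ x, (τ x).trace.re = 1 → quantumForm N (complement V) lam mu τ ≤ v := by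
  classical
  obtain ⟨k, V, hV⟩ := hN.exists_isIsometricExtension
  have cI := continuousOn_nent_map (LinearMap.id : Matrix A A ℂ →ₗ[ℂ] Matrix A A ℂ)
    (fun ρ hρ => hρ)
  have cN := continuousOn_nent_map N (fun ρ hρ => hV.posSemidef hρ)
  have cM := continuousOn_nent_map (complement V) (fun ρ hρ => complement_posSemidef V hρ)
  have cE := continuousOn_entropy_map N (fun ρ hρ => hV.posSemidef hρ)
  obtain ⟨X, Y, _, _, p, ρ, h, hmax⟩ := exists_isMax_ensemble (convex_isDensity (A := A))
    isCompact_isDensity exists_isDensity (F := fun ρ => (1 + mu) * entropy (N ρ))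
    (G := fun _ => 0)
    (H := fun τ => nent τ + lam * nent (N τ) - (1 + lam + mu) * nent (complement V τ))
    (cE.const_mul _) continuousOn_const
    ((cI.add (cN.const_mul _)).sub (cM.const_mul _))
  have hub : ∀ {X' E' : Type} [Fintype X'] [Fintype E'] [DecidableEq E']
      {V' : Matrix (B × E') A ℂ} (τ : X' → Matrix A A ℂ), IsIsometricExtension N V' → (∀ x, (τ x).PosSemidef) →
      ∑ x, (τ x).trace.re = 1 → quantumForm N (complement V') lam mu τ ≤
        quantumForm N (complement V) lam mu
          fun k : X × Y => (p k.1 k.2 : ℂ) • ρ k.1 k.2 := by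
    intro X' E' _ _ _ V' τ hV' hτ htr
    choose ω hω hτω using fun x => eq_trace_smul_isDensity (hτ x)
    -- A one-level ensemble is a two-level one whose second alphabet is a point.
    have h' : IsEnsemble {ρ | IsDensity ρ} (fun x (_ : Unit) => (τ x).trace.re)
        (fun x _ => ω x) :=
      ⟨fun x _ => (Complex.le_def.1 (hτ x).trace_nonneg).1, by simpa using htr, fun x _ => hω x⟩
    have e1 : quantumForm N (complement V') lam mu τ = quantumForm N (complement V) lam mu
        fun k : X' × Unit => (((τ k.1).trace.re : ℝ) : ℂ) • ω k.1 := by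
      have a1 := fun x => nent_complement_eq hV' hV (hτ x)
      simp only [← hτω, quantumForm, Fintype.sum_prod_type, Finset.univ_unique,
        Finset.sum_singleton, a1]
    rw [e1, ← ensemblePoint_eq_quantumForm hV lam mu h, ← ensemblePoint_eq_quantumForm hV lam mu h']
    exact hmax _ _ h'
  refine ⟨quantumForm N (complement V) lam mu fun k : X × Y => (p k.1 k.2 : ℂ) • ρ k.1 k.2,
    ⟨?_, ?_⟩, hub⟩
  -- Purifying each optimal input realizes the maximum by an admissible quantum state.
  · choose φ hφ hφρ using fun k : X × Y => exists_inputState_eq (h.mem k.1 k.2)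
    refine ⟨X × Y, Fin (Fintype.card A), Fin k, inferInstance, inferInstance, inferInstance,
      inferInstance, inferInstance, V, fun k => p k.1 k.2, φ, hV, fun k => h.nonneg _ _,
      ?_, hφ, ?_⟩
    · rw [Fintype.sum_prod_type, h.sum_eq_one]
    · rw [quantumObjective_eq hV lam mu (fun k => h.nonneg _ _)]
      simp only [inputState_smul (h.nonneg _ _), hφρ]
  · rintro _ ⟨X', R', E', _, _, _, _, _, V', p', φ', hV', hp', hp1', hφ', rfl⟩
    rw [quantumObjective_eq hV' lam mu hp']
    refine hub _ hV' (fun x => inputState_posSemidef _) ?_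
    rw [← hp1']
    refine Finset.sum_congr rfl fun x _ => ?_
    rw [inputState_smul (hp' x), Matrix.trace_smul, trace_inputState, hφ']
    simp

end Maxima

end PrivateDynamic

theorem mainTheorem10 {A B : Type*} [Fintype A] [DecidableEq A] [Nonempty A]
    [Fintype B] [DecidableEq B] (N : Matrix A A ℂ →ₗ[ℂ] Matrix B B ℂ)
    (hN : PrivateDynamic.IsChannel N) (hdeg : PrivateDynamic.IsDegradable N)
    (lam mu : ℝ) (hlam : 0 ≤ lam) (hmu : 0 ≤ mu) :
    IsGreatest (PrivateDynamic.privateValues lam mu N) (PrivateDynamic.privateFormula lam mu N) ∧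
      IsGreatest (PrivateDynamic.quantumValues lam mu N)
        (PrivateDynamic.quantumFormula lam mu N) ∧
      PrivateDynamic.privateFormula lam mu N ≤ PrivateDynamic.quantumFormula lam mu N := by
  obtain ⟨v, hv⟩ := PrivateDynamic.exists_isGreatest_privateValues hN lam mu
  obtain ⟨w, hw, hle⟩ := PrivateDynamic.exists_isGreatest_quantumValues hN lam mu
  rw [PrivateDynamic.privateFormula, PrivateDynamic.quantumFormula, hv.csSup_eq, hw.csSup_eq]
  refine ⟨hv, hw, ?_⟩
  -- The private maximum is attained, so it suffices to compare at one maximizing ensemble.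
  obtain ⟨X, Y, E, _, _, _, _, _, _, V, p, ρ, hV, hp, hp1, hρ, rfl⟩ := hv.1
  have hτ : ∀ x y, ((p x y : ℂ) • ρ x y).PosSemidef := fun x y =>
    (hρ x y).1.smul (by exact_mod_cast hp x y)
  rw [PrivateDynamic.privateObjective_eq hV lam mu hτ]
  refine (PrivateDynamic.privateForm_le_quantumForm hdeg hV hlam hmu _ hτ).trans
    (hle _ hV (fun x => Matrix.posSemidef_sum _ fun y _ => hτ x y) ?_)
  rw [← hp1]
  refine Finset.sum_congr rfl fun x _ => ?_
  simp [Matrix.trace_sum, (hρ _ _).2]
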